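/- For positive integers $n$ and $m$, let $p_n(m)$ be the probability that a uniformly random permutation of $\{1,\dots,n\}$ has order exactly $m$, and let $M(n)=\max_{m} p_n(m)$. Let $$K_n=\bigl\{k\in\{0,1,\dots,n-1\} : \operatorname{lcm}(1,2,\dots,k)\mid n-k\bigr\},$$ where the least common multiple of the empty list is $1$. Then $M(n)\sim 1/n$, that is, $\lim_{n\to\infty} n\,M(n)=1$. Moreover, there is $n_0$ such that for every $n\ge n_0$, every $m$ with $p_n(m)\ge 1/n$ is of the form $m=n-k$ for some $k\in K_n$. -/

import Mathlib

/-- `orderProb n m` is the probability that a uniformly random permutation of an `n`-element set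
has order exactly `m`. -/
noncomputable def orderProb (n m : ℕ) : ℝ :=
  (Finset.card {σ : Equiv.Perm (Fin n) | orderOf σ = m} : ℝ) / (Nat.factorial n : ℝ)

/-- The supremum over all `m` of the probability that a uniformly random permutation of an
`n`-element set has order `m`; it is a maximum, see `isGreatest_maxOrderProb`. -/
noncomputable def maxOrderProb (n : ℕ) : ℝ :=
  ⨆ m : ℕ, orderProb n m

/-- The set of `k ∈ {0, …, n - 1}` such that `lcm(1, 2, …, k)` divides `n - k`
(the subtraction is exact because `k < n`). -/
def cycleDefects (n : ℕ) : Finset ℕ :=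
  {k ∈ Finset.range n | (Finset.Icc 1 k).lcm id ∣ n - k}

/-- The supremum defining `maxOrderProb` is attained (so it is not a junk value). -/
theorem isGreatest_maxOrderProb (n : ℕ) :
    IsGreatest (Set.range (orderProb n)) (maxOrderProb n) := by
  have hfin : (Set.range (orderProb n)).Finite := by
    refine ((Set.finite_Iic (Nat.factorial n)).image
      (fun c : ℕ => (c : ℝ) / (Nat.factorial n : ℝ))).subset ?_
    rintro _ ⟨m, rfl⟩
    refine ⟨Finset.card {σ : Equiv.Perm (Fin n) | orderOf σ = m}, ?_, rfl⟩
    have h := Finset.card_le_univ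
      ({σ : Equiv.Perm (Fin n) | orderOf σ = m} : Finset (Equiv.Perm (Fin n)))
    rwa [Fintype.card_perm, Fintype.card_fin] at h
  have hne : (Set.range (orderProb n)).Nonempty := Set.range_nonempty _
  exact ⟨hne.csSup_mem hfin, fun _ hx => le_csSup hfin.bddAbove hx⟩

/-!
# The most likely order of a random permutation

Write `n = exp (u ^ 64)`. Removing the cycle through a fixed point, whose length `n - k` is
uniformly distributed, gives `n * orderProb n m = ∑ T k`, summed over the `k < n` with
`n - k ∣ m`, where `T k` is the probability that a random permutation of the remaining `k` points
has an order whose lcm with `n - k` is `m` (`nat_mul_orderProb`). The claim is that, for large `n`,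
this sum is below `1` unless a single small `k` carries almost all of it.

Two estimates carry the proof.

* Covering (`shapeProb_forall_exists_dvd_le`): if the order is `m`, each prime power exactly
  dividing `m` divides some cycle length, and for prime powers `q₁, …, qᵣ` this has probability at most
  `A ^ r / (q₁ ⋯ qᵣ)` with `A` of the size of `r` plus the logarithm of the number of points. So if
  `m` has many exact prime powers above `u ^ 66` (a little more than `log n`), then order `m` has
  probability at most `n ^ (-2)`; otherwise `m` has at most `2 u ^ 66` prime factors.
* Counting divisors: an integer with so few prime factors has at most `k ^ (3/16)` divisors up to
  `k` when `k ≥ exp (u ^ 60)`, by Rankin's trick (`card_smallDivisors_le`). Hence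
  `T k ≤ k ^ (-13/16)`, and at most `k ^ (1/4)` divisors of `m` lie in `[n - k, n]`
  (`card_divisors_Icc_le`), so that all defects `k ≥ exp x` together contribute at most
  `2 exp (-x / 4)` (`sum_defectProb_le`).

If two defects below `exp (8 u ^ 60)` occur, then `m` is a common multiple of two integers close to
`n` and to each other, so `m / (n - k) ≥ n ^ (1/2)` for every small defect `k`; its prime powers
must be covered by cycles on only `k < exp (u ^ 60)` points, and the covering estimate makes every `T k`
tiny. Otherwise at most one small `k` occurs, and the sum is at most `T k + 2 exp (-2 u ^ 60)`.
Finally `T k ≤ 1 - 1 / k` unless `m = n - k` and `lcm (1, …, k) ∣ m`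
(`defectProb_eq_zero_or_le`), and `1 / k` exceeds the error term. The lower bound comes from the
`n`-cycles, which have order `n`.

The exponents of `u` only have to be ordered suitably: the covering thresholds `u ^ 66` and `u ^ 62`
exceed the harmonic sums up to `n` and up to `exp (u ^ 60)` by about a factor `u ^ 2`,
prime powers below `u ^ 62` have product at most `n ^ o(1)`, and Rankin's trick with exponent `1/8`
turns `2 u ^ 66` prime factors into an error `O (u ^ 59)` in the logarithm, negligible beside
`u ^ 60`.
-/

open Finset

/-! ### Cycle lengths of a random permutation -/

/-- The multisets of positive integers with sum `n`: the possible multisets of cycle lengths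
(fixed points included) of a permutation of an `n`-element set. -/
def cycleShapes (n : ℕ) : Finset (Multiset ℕ) :=
  (univ : Finset n.Partition).image Nat.Partition.parts

/-- The proportion of permutations whose multiset of cycle lengths is `s`, namely
`1 / ∏ i ^ cᵢ cᵢ!` with `cᵢ` the multiplicity of `i` in `s`. -/
noncomputable def shapeWeight (s : Multiset ℕ) : ℝ :=
  ((s.prod * ∏ i ∈ s.toFinset, (s.count i).factorial : ℕ) : ℝ)⁻¹

/-- The expectation of a function of the multiset of cycle lengths of a uniformly random
permutation of an `n`-element set. -/
noncomputable def shapeExp (n : ℕ) (F : Multiset ℕ → ℝ) : ℝ :=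
  ∑ s ∈ cycleShapes n, shapeWeight s * F s

theorem mem_cycleShapes {n : ℕ} {s : Multiset ℕ} :
    s ∈ cycleShapes n ↔ (∀ i ∈ s, 0 < i) ∧ s.sum = n := by
  constructor
  · intro h
    obtain ⟨p, -, rfl⟩ := mem_image.1 h
    exact ⟨fun i hi => p.parts_pos hi, p.parts_sum⟩
  · rintro ⟨h1, h2⟩
    exact mem_image.2 ⟨⟨s, fun {i} hi => h1 i hi, h2⟩, mem_univ _, rfl⟩

theorem prod_factorial_count_cons (a : ℕ) (s : Multiset ℕ) :
    ∏ i ∈ (a ::ₘ s).toFinset, ((a ::ₘ s).count i).factorial =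
      (s.count a + 1) * ∏ i ∈ s.toFinset, (s.count i).factorial := by
  have h1 : ∏ i ∈ s.toFinset, (s.count i).factorial =
      ∏ i ∈ (a ::ₘ s).toFinset, (s.count i).factorial := by
    apply prod_subset
    · intro i hi
      simp only [Multiset.mem_toFinset, Multiset.mem_cons] at *
      exact Or.inr hi
    · intro i _ hi
      rw [Multiset.mem_toFinset] at hi
      rw [Multiset.count_eq_zero_of_notMem hi, Nat.factorial_zero]
  have h2 : ∀ i ∈ (a ::ₘ s).toFinset, ((a ::ₘ s).count i).factorial =
      (if a = i then s.count i + 1 else 1) * (s.count i).factorial := by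
    intro i _
    rw [Multiset.count_cons]
    by_cases h : i = a
    · simp [h, Nat.factorial_succ]
    · simp [h, Ne.symm h]
  rw [prod_congr rfl h2, prod_mul_distrib, h1, prod_ite_eq, if_pos]
  simp

theorem shapeWeight_cons {a : ℕ} (ha : 0 < a) (s : Multiset ℕ) :
    shapeWeight (a ::ₘ s) * (s.count a + 1 : ℕ) = (1 / (a : ℝ)) * shapeWeight s := by
  have ha' : (a : ℝ) ≠ 0 := by positivity
  have hc : ((s.count a + 1 : ℕ) : ℝ) ≠ 0 := by positivity
  unfold shapeWeight
  rw [prod_factorial_count_cons, Multiset.prod_cons]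
  rw [show a * s.prod * ((s.count a + 1) * ∏ i ∈ s.toFinset, (s.count i).factorial) =
    a * (s.count a + 1) * (s.prod * ∏ i ∈ s.toFinset, (s.count i).factorial) by ring,
    Nat.cast_mul (a * _), Nat.cast_mul a, mul_inv, mul_inv]
  field_simp

theorem shapeWeight_nonneg (s : Multiset ℕ) : 0 ≤ shapeWeight s := by
  unfold shapeWeight; positivity

/-- Marking a cycle: choosing a cycle of a random permutation of `n` points and deleting it is, in
expectation, the same as choosing a length `ℓ` with weight `1 / ℓ` and a random permutation of the
remaining `n - ℓ` points. -/
theorem shapeExp_marked (n : ℕ) (G : ℕ → Multiset ℕ → ℝ) :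
    shapeExp n (fun s => (s.map fun a => G a (s.erase a)).sum) =
      ∑ a ∈ Icc 1 n, (1 / (a : ℝ)) * shapeExp (n - a) (G a) := by
  unfold shapeExp
  simp_rw [Finset.sum_multiset_map_count, mul_sum]
  rw [sum_sigma', sum_sigma']
  refine sum_bij' (fun x _ => ⟨x.2, x.1.erase x.2⟩) (fun y _ => ⟨y.1 ::ₘ y.2, y.1⟩) ?_ ?_ ?_ ?_ ?_
  · rintro ⟨s, a⟩ h
    simp only [mem_sigma, Multiset.mem_toFinset, mem_cycleShapes, mem_Icc] at h ⊢
    obtain ⟨⟨h1, h2⟩, h3⟩ := h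
    have h4 : a + (s.erase a).sum = n := by
      rw [← Multiset.sum_cons, Multiset.cons_erase h3, h2]
    exact ⟨⟨h1 a h3, by lia⟩, fun i hi => h1 i (Multiset.mem_of_mem_erase hi), by lia⟩
  · rintro ⟨a, s⟩ h
    simp only [mem_sigma, Multiset.mem_toFinset, mem_cycleShapes, mem_Icc] at h ⊢
    obtain ⟨h1, h2, h3⟩ := h
    refine ⟨⟨fun i hi => ?_, ?_⟩, Multiset.mem_cons_self _ _⟩
    · rcases Multiset.mem_cons.1 hi with rfl | hi
      · exact h1.1
      · exact h2 i hi
    · rw [Multiset.sum_cons, h3]; lia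
  · rintro ⟨s, a⟩ h
    simp only [mem_sigma, Multiset.mem_toFinset] at h
    simp only [Multiset.cons_erase h.2]
  · rintro ⟨a, s⟩ h
    simp only [Multiset.erase_cons_head]
  · rintro ⟨s, a⟩ h
    simp only [mem_sigma, Multiset.mem_toFinset, mem_cycleShapes] at h
    obtain ⟨⟨h1, h2⟩, h3⟩ := h
    have h4 := shapeWeight_cons (h1 a h3) (s.erase a)
    rw [Multiset.cons_erase h3, Multiset.count_erase_self] at h4
    have h5 : 1 ≤ s.count a := Multiset.one_le_count_iff_mem.2 h3
    rw [Nat.sub_add_cancel h5] at h4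
    rw [nsmul_eq_mul, ← mul_assoc, h4]
    ring

/-- The cycle containing a fixed point has a uniformly distributed length `a`, and the rest is a
uniformly random permutation of the remaining `n - a` points. -/
theorem nat_mul_shapeExp (n : ℕ) (F : Multiset ℕ → ℝ) :
    n * shapeExp n F = ∑ a ∈ Icc 1 n, shapeExp (n - a) (fun s => F (a ::ₘ s)) := by
  have h := shapeExp_marked n (fun a s => a * F (a ::ₘ s))
  have h1 : shapeExp n (fun s => (s.map fun a : ℕ => (a : ℝ) * F (a ::ₘ s.erase a)).sum) =
      n * shapeExp n F := by
    unfold shapeExp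
    rw [mul_sum]
    refine sum_congr rfl fun s hs => ?_
    have h2 : (s.map fun a : ℕ => (a : ℝ) * F (a ::ₘ s.erase a)) = s.map fun a : ℕ => (a : ℝ) * F s :=
      Multiset.map_congr rfl fun a ha => by rw [Multiset.cons_erase ha]
    beta_reduce
    rw [h2, Multiset.sum_map_mul_right, ← Nat.cast_multiset_sum, (mem_cycleShapes.1 hs).2]
    ring
  rw [← h1, h]
  refine sum_congr rfl fun a ha => ?_
  have ha' : (a : ℝ) ≠ 0 := by
    have := (mem_Icc.1 ha).1
    positivity
  unfold shapeExp
  rw [mul_sum]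
  refine sum_congr rfl fun s _ => ?_
  field_simp

theorem shapeExp_mono {n : ℕ} {F G : Multiset ℕ → ℝ} (h : ∀ s ∈ cycleShapes n, F s ≤ G s) :
    shapeExp n F ≤ shapeExp n G :=
  sum_le_sum fun s hs => mul_le_mul_of_nonneg_left (h s hs) (shapeWeight_nonneg s)

theorem shapeExp_congr {n : ℕ} {F G : Multiset ℕ → ℝ} (h : ∀ s ∈ cycleShapes n, F s = G s) :
    shapeExp n F = shapeExp n G :=
  sum_congr rfl fun s hs => by rw [h s hs]

theorem shapeExp_nonneg {n : ℕ} {F : Multiset ℕ → ℝ} (h : ∀ s ∈ cycleShapes n, 0 ≤ F s) :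
    0 ≤ shapeExp n F :=
  sum_nonneg fun s hs => mul_nonneg (shapeWeight_nonneg s) (h s hs)

theorem cycleShapes_zero : cycleShapes 0 = {0} := by
  ext s
  rw [mem_cycleShapes, mem_singleton]
  constructor
  · rintro ⟨h1, h2⟩
    refine Multiset.eq_zero_of_forall_notMem fun a ha => ?_
    have := Multiset.le_sum_of_mem ha
    have := h1 a ha
    lia
  · rintro rfl
    simp

theorem shapeExp_zero (F : Multiset ℕ → ℝ) : shapeExp 0 F = F 0 := by
  simp [shapeExp, cycleShapes_zero, shapeWeight]

theorem shapeExp_one (n : ℕ) : shapeExp n (fun _ => 1) = 1 := by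
  induction n using Nat.strong_induction_on with
  | _ n ih =>
    rcases Nat.eq_zero_or_pos n with rfl | hn
    · exact shapeExp_zero _
    · have h := nat_mul_shapeExp n (fun _ => 1)
      rw [sum_congr rfl fun a ha => ih (n - a) (by have := mem_Icc.1 ha; lia)] at h
      rw [sum_const, Nat.card_Icc, Nat.add_sub_cancel, nsmul_eq_mul] at h
      have : (n : ℝ) ≠ 0 := by positivity
      exact mul_left_cancel₀ this h

/-- The probability that the multiset of cycle lengths of a uniformly random permutation of an
`n`-element set satisfies `p`. -/
noncomputable def shapeProb (n : ℕ) (p : Multiset ℕ → Prop) : ℝ :=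
  open Classical in shapeExp n (fun s => if p s then 1 else 0)

theorem shapeProb_nonneg (n : ℕ) (p : Multiset ℕ → Prop) : 0 ≤ shapeProb n p :=
  shapeExp_nonneg fun s _ => by split_ifs <;> norm_num

theorem shapeProb_mono {n : ℕ} {p q : Multiset ℕ → Prop} (h : ∀ s ∈ cycleShapes n, p s → q s) :
    shapeProb n p ≤ shapeProb n q :=
  shapeExp_mono fun s hs => by
    by_cases hp : p s
    · simp [hp, h s hs hp]
    · rw [if_neg hp]; split_ifs <;> norm_num

theorem shapeProb_le_one (n : ℕ) (p : Multiset ℕ → Prop) : shapeProb n p ≤ 1 :=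
  (shapeExp_mono fun s _ => by split_ifs <;> norm_num).trans (shapeExp_one n).le

theorem shapeProb_eq_zero {n : ℕ} {p : Multiset ℕ → Prop} (h : ∀ s ∈ cycleShapes n, ¬ p s) :
    shapeProb n p = 0 := by
  unfold shapeProb shapeExp
  exact Finset.sum_eq_zero fun s hs => by simp [h s hs]

theorem shapeProb_eq_one {n : ℕ} {p : Multiset ℕ → Prop} (h : ∀ s ∈ cycleShapes n, p s) :
    shapeProb n p = 1 := by
  rw [← shapeExp_one n]
  exact shapeExp_congr fun s hs => by simp [h s hs]

theorem nat_mul_shapeProb (n : ℕ) (p : Multiset ℕ → Prop) :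
    n * shapeProb n p = ∑ a ∈ Icc 1 n, shapeProb (n - a) (fun s => p (a ::ₘ s)) :=
  nat_mul_shapeExp n _

theorem lcm_replicate_one (k : ℕ) : (Multiset.replicate k 1).lcm = 1 := by
  refine Nat.dvd_one.1 (Multiset.lcm_dvd.2 fun b hb => ?_)
  rw [Multiset.eq_of_mem_replicate hb]

/-- The number of permutations of a type with `n` elements with a given multiset `s` of cycle
lengths, fixed points included. -/
theorem card_parts_eq {n : ℕ} {s : Multiset ℕ} (hs : s ∈ cycleShapes n) :
    (#{σ : Equiv.Perm (Fin n) | σ.partition.parts = s} : ℝ) = n.factorial * shapeWeight s := by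
  obtain ⟨hpos, hsum⟩ := mem_cycleShapes.1 hs
  set t := s.filter (fun i => 2 ≤ i) with ht
  have hst : s = t + Multiset.replicate (s.count 1) 1 := by
    conv_lhs => rw [← Multiset.filter_add_not (fun i => 2 ≤ i) s]
    congr 1
    rw [← Multiset.filter_eq']
    refine Multiset.filter_congr fun i hi => ?_
    have := hpos i hi
    lia
  have hsum' : t.sum + s.count 1 = n := by
    rw [← hsum]
    conv_rhs => rw [hst]
    simp
  have hset : ({σ : Equiv.Perm (Fin n) | σ.partition.parts = s} : Finset _) =
      ({σ : Equiv.Perm (Fin n) | σ.cycleType = t} : Finset _) := by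
    ext σ
    simp only [mem_filter, mem_univ, true_and]
    constructor
    · intro h
      rw [← Equiv.Perm.filter_parts_partition_eq_cycleType, h]
    · intro h
      rw [Equiv.Perm.parts_partition, h, ← Equiv.Perm.sum_cycleType, h, Fintype.card_fin,
        show n - t.sum = s.count 1 by lia]
      exact hst.symm
  have h := Equiv.Perm.card_of_cycleType_mul_eq (Fin n) t
  rw [if_pos ⟨by rw [Fintype.card_fin]; lia, fun a ha => (Multiset.mem_filter.1 ha).2⟩,
    Fintype.card_fin, show n - t.sum = s.count 1 by lia] at h
  have hz : (s.count 1).factorial * t.prod * ∏ i ∈ t.toFinset, (t.count i).factorial =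
      s.prod * ∏ i ∈ s.toFinset, (s.count i).factorial := by
    have h1 : s.prod = t.prod := by
      conv_lhs => rw [hst]
      simp
    have h2 : ∏ i ∈ s.toFinset, (s.count i).factorial =
        (s.count 1).factorial * ∏ i ∈ t.toFinset, (t.count i).factorial := by
      have h3 : ∏ i ∈ insert 1 s.toFinset, (s.count i).factorial =
          ∏ i ∈ s.toFinset, (s.count i).factorial := by
        refine prod_insert_of_eq_one_if_notMem fun hi => ?_
        rw [Multiset.mem_toFinset] at hi
        rw [Multiset.count_eq_zero_of_notMem hi, Nat.factorial_zero]
      have h4 : insert 1 s.toFinset = insert 1 t.toFinset := by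
        ext i
        simp only [mem_insert, Multiset.mem_toFinset, ht, Multiset.mem_filter]
        constructor
        · rintro (h | h)
          · exact Or.inl h
          · have := hpos i h
            by_cases hi : i = 1
            · exact Or.inl hi
            · exact Or.inr ⟨h, by lia⟩
        · rintro (h | h)
          · exact Or.inl h
          · exact Or.inr h.1
      rw [← h3, h4, prod_insert (by simp [ht])]
      congr 1
      refine prod_congr rfl fun i hi => ?_
      rw [ht, Multiset.count_filter_of_pos]
      rw [Multiset.mem_toFinset, ht, Multiset.mem_filter] at hi
      exact hi.2
    rw [h1, h2]
    ring
  rw [hz] at h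
  rw [hset, ← h, shapeWeight]
  have h0 : ((s.prod * ∏ i ∈ s.toFinset, (s.count i).factorial : ℕ) : ℝ) ≠ 0 := by
    intro h0
    rw [Nat.cast_eq_zero] at h0
    rw [h0, mul_zero] at h
    exact n.factorial_ne_zero h.symm
  rw [Nat.cast_mul, mul_assoc, mul_inv_cancel₀ h0, mul_one]

theorem orderProb_eq_shapeProb (n m : ℕ) : orderProb n m = shapeProb n (fun s => s.lcm = m) := by
  have hlcm : ∀ σ : Equiv.Perm (Fin n), σ.partition.parts.lcm = orderOf σ := by
    intro σ
    rw [Equiv.Perm.parts_partition, Multiset.lcm_add, lcm_replicate_one,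
      ← Equiv.Perm.lcm_cycleType]
    exact Nat.lcm_one_right _
  have hmem : ∀ σ : Equiv.Perm (Fin n), σ.partition.parts ∈ cycleShapes n := fun σ =>
    mem_cycleShapes.2 ⟨fun i hi => σ.partition.parts_pos hi, by
      rw [σ.partition.parts_sum, Fintype.card_fin]⟩
  have hn : (n.factorial : ℝ) ≠ 0 := by positivity
  rw [orderProb, div_eq_iff hn, shapeProb, shapeExp, sum_mul,
    card_eq_sum_card_fiberwise (f := fun σ => σ.partition.parts) (t := cycleShapes n)
      (fun σ _ => hmem σ), Nat.cast_sum]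
  refine sum_congr rfl fun s hs => ?_
  split_ifs with h
  · rw [mul_one, mul_comm, ← card_parts_eq hs, filter_filter]
    congr 2
    ext σ
    simp only [mem_filter, mem_univ, true_and]
    exact ⟨fun h => h.2, fun h' => ⟨by rw [← hlcm, h', h], h'⟩⟩
  · rw [mul_zero, zero_mul, Nat.cast_eq_zero, card_eq_zero, filter_filter]
    refine filter_eq_empty_iff.2 fun σ _ h' => h ?_
    rw [← h'.2, hlcm, h'.1]

/-! ### Covering by cycle lengths -/

theorem card_filter_dvd_eq_sum_map (q : ℕ) (s : Multiset ℕ) :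
    ((s.filter (q ∣ ·)).card : ℝ) = (s.map fun a => if q ∣ a then (1 : ℝ) else 0).sum := by
  induction s using Multiset.induction_on with
  | empty => simp
  | cons a s ih =>
    rw [Multiset.filter_cons, Multiset.map_cons, Multiset.sum_cons, Multiset.card_add,
      Nat.cast_add, ih]
    split_ifs <;> simp

theorem prod_sum_card_filter_dvd_erase {ι : Type*} [DecidableEq ι] (P : Finset ι) (q : ι → ℕ)
    {s : Multiset ℕ} {a : ℕ} (ha : a ∈ s) :
    ∏ i ∈ P, ((s.filter (q i ∣ ·)).card : ℝ) =
      ∑ T ∈ P.powerset, (if ∀ i ∈ T, q i ∣ a then 1 else 0) *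
        ∏ i ∈ P \ T, (((s.erase a).filter (q i ∣ ·)).card : ℝ) := by
  have h : ∀ i, ((s.filter (q i ∣ ·)).card : ℝ) =
      (if q i ∣ a then 1 else 0) + (((s.erase a).filter (q i ∣ ·)).card : ℝ) := by
    intro i
    conv_lhs => rw [← Multiset.cons_erase ha]
    rw [Multiset.filter_cons, Multiset.card_add, Nat.cast_add]
    split_ifs <;> simp
  rw [prod_congr rfl fun i _ => h i, prod_add]
  refine sum_congr rfl fun T _ => ?_
  congr 1
  rw [prod_ite_zero]
  simp

theorem sum_inv_multiples_le {n N b : ℕ} (hb : 0 < b) (hn : n ≤ N) {H : ℝ}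
    (hH : ∑ a ∈ Icc 1 N, 1 / (a : ℝ) ≤ H) :
    ∑ a ∈ Icc 1 n with b ∣ a, 1 / (a : ℝ) ≤ H / b := by
  have hb' : (0 : ℝ) < b := by positivity
  have hsub : ((Icc 1 n).filter (b ∣ ·)) ⊆ (Icc 1 N).image (b * ·) := by
    intro a ha
    obtain ⟨ha, c, rfl⟩ := mem_filter.1 ha
    rw [mem_Icc] at ha
    refine mem_image.2 ⟨c, mem_Icc.2 ⟨?_, ?_⟩, rfl⟩
    · by_contra hc
      have : c = 0 := by lia
      simp [this] at ha
    · nlinarith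
  calc ∑ a ∈ Icc 1 n with b ∣ a, 1 / (a : ℝ)
      ≤ ∑ a ∈ (Icc 1 N).image (b * ·), 1 / (a : ℝ) :=
        sum_le_sum_of_subset_of_nonneg hsub fun _ _ _ => by positivity
    _ = ∑ c ∈ Icc 1 N, 1 / ((b * c : ℕ) : ℝ) :=
        sum_image fun x _ y _ h => Nat.eq_of_mul_eq_mul_left hb h
    _ = (∑ c ∈ Icc 1 N, 1 / (c : ℝ)) / b := by
        rw [sum_div]
        refine sum_congr rfl fun c _ => ?_
        rw [Nat.cast_mul, div_div, mul_comm]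
    _ ≤ H / b := by gcongr

theorem mul_add_one_pow_le {A H : ℝ} (hH : 0 ≤ H) (hHA : 3 * H ≤ A) (hA : 0 < A) {r : ℕ}
    (hr : (r : ℝ) ≤ A) : H * (1 + A) ^ r ≤ A ^ (r + 1) := by
  have h1 : (1 + A) ^ r ≤ 3 * A ^ r := by
    have h2 : (1 + A) = A * (1 + 1 / A) := by field_simp; ring
    have h3 : (1 + 1 / A) ^ r ≤ 3 := by
      calc (1 + 1 / A) ^ r ≤ (Real.exp (1 / A)) ^ r := by
            gcongr
            rw [add_comm]
            exact Real.add_one_le_exp _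
        _ = Real.exp (r / A) := by rw [← Real.exp_nat_mul]; ring_nf
        _ ≤ Real.exp 1 := Real.exp_le_exp.2 ((div_le_one hA).2 hr)
        _ ≤ 3 := by linarith [Real.exp_one_lt_d9]
    rw [h2, mul_pow, mul_comm]
    gcongr
  calc H * (1 + A) ^ r ≤ H * (3 * A ^ r) := by gcongr
    _ = (3 * H) * A ^ r := by ring
    _ ≤ A * A ^ r := by gcongr
    _ = A ^ (r + 1) := by ring

/-- The mixed moment of the numbers `C_q` of cycles whose length is a multiple of `q`, for `q` in a
finite set of pairwise coprime integers. Marking a cycle counted by one of the `C_q` and splitting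
the other factors according to which `q` divide its length gives an induction on the set. -/
theorem shapeExp_prod_card_filter_dvd_le {ι : Type*} [DecidableEq ι] (q : ι → ℕ) {N : ℕ}
    {A H : ℝ} (hH0 : 0 ≤ H) (hH : ∑ a ∈ Icc 1 N, 1 / (a : ℝ) ≤ H) (hHA : 3 * H ≤ A) (hA : 0 < A)
    (P : Finset ι) (hq : ∀ i ∈ P, 0 < q i)
    (hcop : ∀ i ∈ P, ∀ j ∈ P, i ≠ j → Nat.Coprime (q i) (q j)) (hP : (#P : ℝ) ≤ A)
    {n : ℕ} (hn : n ≤ N) :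
    shapeExp n (fun s => ∏ i ∈ P, ((s.filter (q i ∣ ·)).card : ℝ)) ≤
      A ^ #P / ∏ i ∈ P, (q i : ℝ) := by
  induction P using Finset.strongInduction generalizing n with
  | H P ih =>
    rcases P.eq_empty_or_nonempty with rfl | ⟨i₀, hi₀⟩
    · simp [shapeExp_one]
    obtain ⟨P', hi₀', rfl⟩ : ∃ P', i₀ ∉ P' ∧ P = insert i₀ P' :=
      ⟨P.erase i₀, notMem_erase _ _, (insert_erase hi₀).symm⟩
    rw [card_insert_of_notMem hi₀', prod_insert hi₀'] at *
    have hq0 : (0 : ℝ) < q i₀ := by exact_mod_cast hq i₀ hi₀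
    have hq' : ∀ i ∈ P', (0 : ℝ) < q i := fun i hi => by
      exact_mod_cast hq i (mem_insert_of_mem hi)
    have hrle : ((#P' : ℕ) : ℝ) ≤ A := le_trans (by push_cast; linarith) hP
    calc shapeExp n (fun s => ∏ i ∈ insert i₀ P', ((s.filter (q i ∣ ·)).card : ℝ))
        = shapeExp n (fun s => (s.map fun a => (if q i₀ ∣ a then (1 : ℝ) else 0) *
            ∑ T ∈ P'.powerset, (if ∀ i ∈ T, q i ∣ a then 1 else 0) *
              ∏ i ∈ P' \ T, (((s.erase a).filter (q i ∣ ·)).card : ℝ)).sum) := by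
          refine shapeExp_congr fun s _ => ?_
          rw [prod_insert hi₀']
          rw [card_filter_dvd_eq_sum_map, ← Multiset.sum_map_mul_right]
          congr 1
          exact Multiset.map_congr rfl fun a ha => by
            rw [prod_sum_card_filter_dvd_erase P' q ha]
      _ = ∑ a ∈ Icc 1 n, (1 / (a : ℝ)) * ∑ T ∈ P'.powerset,
            (if q i₀ ∣ a ∧ ∀ i ∈ T, q i ∣ a then 1 else 0) * shapeExp (n - a) (fun s =>
              ∏ i ∈ P' \ T, ((s.filter (q i ∣ ·)).card : ℝ)) := by
          rw [shapeExp_marked n (fun a t => (if q i₀ ∣ a then (1 : ℝ) else 0) *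
            ∑ T ∈ P'.powerset, (if ∀ i ∈ T, q i ∣ a then 1 else 0) *
              ∏ i ∈ P' \ T, ((t.filter (q i ∣ ·)).card : ℝ))]
          refine sum_congr rfl fun a _ => ?_
          congr 1
          unfold shapeExp
          simp_rw [mul_sum]
          rw [sum_comm]
          refine sum_congr rfl fun T _ => sum_congr rfl fun s _ => ?_
          rw [ite_and]
          split_ifs <;> ring
      _ ≤ ∑ a ∈ Icc 1 n, (1 / (a : ℝ)) * ∑ T ∈ P'.powerset,
            (if q i₀ ∣ a ∧ ∀ i ∈ T, q i ∣ a then 1 else 0) *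
              (A ^ #(P' \ T) / ∏ i ∈ P' \ T, (q i : ℝ)) := by
          refine sum_le_sum fun a ha => mul_le_mul_of_nonneg_left
            (sum_le_sum fun T _ => mul_le_mul_of_nonneg_left ?_ ?_) (by positivity)
          · have hsub : P' \ T ⊆ P' := sdiff_subset
            refine ih _ ?_ (fun i hi => hq i (mem_insert_of_mem (hsub hi)))
              (fun i hi j hj => hcop i (mem_insert_of_mem (hsub hi)) j
                (mem_insert_of_mem (hsub hj))) ?_ (by lia)
            · exact (ssubset_iff_of_subset (hsub.trans (subset_insert _ _))).2
                ⟨i₀, mem_insert_self _ _, fun h => hi₀' (hsub h)⟩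
            · exact le_trans (by exact_mod_cast card_le_card hsub) hrle
          · split_ifs <;> norm_num
      _ = ∑ T ∈ P'.powerset, (A ^ #(P' \ T) / ∏ i ∈ P' \ T, (q i : ℝ)) *
            ∑ a ∈ Icc 1 n with (q i₀ * ∏ i ∈ T, q i) ∣ a, (1 / (a : ℝ)) := by
          simp_rw [mul_sum]
          rw [sum_comm]
          refine sum_congr rfl fun T hT => ?_
          rw [sum_filter]
          refine sum_congr rfl fun a _ => ?_
          have hTP := mem_powerset.1 hT
          have hiff : (q i₀ * ∏ i ∈ T, q i) ∣ a ↔ (q i₀ ∣ a ∧ ∀ i ∈ T, q i ∣ a) := by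
            constructor
            · exact fun h => ⟨(dvd_mul_right _ _).trans h, fun i hi =>
                ((dvd_prod_of_mem q hi).trans (dvd_mul_left _ _)).trans h⟩
            · rintro ⟨h1, h2⟩
              refine Nat.Coprime.mul_dvd_of_dvd_of_dvd ?_ h1 ?_
              · exact Nat.Coprime.prod_right fun i hi => hcop _ (mem_insert_self _ _) _
                  (mem_insert_of_mem (hTP hi)) fun h => hi₀' (h ▸ hTP hi)
              · refine Finset.prod_dvd_of_isRelPrime (fun i hi j hj hij => ?_) h2
                exact Nat.coprime_iff_isRelPrime.1 (hcop i (mem_insert_of_mem (hTP hi)) j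
                  (mem_insert_of_mem (hTP hj)) hij)
          simp only [hiff]
          split_ifs <;> ring
      _ ≤ ∑ T ∈ P'.powerset, (A ^ #(P' \ T) / ∏ i ∈ P' \ T, (q i : ℝ)) *
            (H / (q i₀ * ∏ i ∈ T, q i : ℕ)) := by
          refine sum_le_sum fun T hT => mul_le_mul_of_nonneg_left ?_ ?_
          · refine sum_inv_multiples_le ?_ hn hH
            refine Nat.mul_pos (hq _ (mem_insert_self _ _)) (prod_pos fun i hi => ?_)
            exact hq i (mem_insert_of_mem (mem_powerset.1 hT hi))
          · positivity
      _ = ∑ T ∈ P'.powerset, A ^ (#P' - #T) * (H / (q i₀ * ∏ i ∈ P', (q i : ℝ))) := by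
          refine sum_congr rfl fun T hT => ?_
          have hTP := mem_powerset.1 hT
          rw [card_sdiff_of_subset hTP, ← prod_sdiff hTP]
          have h1 : (0 : ℝ) < ∏ i ∈ P' \ T, (q i : ℝ) := prod_pos fun i hi => hq' i (sdiff_subset hi)
          have h2 : (0 : ℝ) < ∏ i ∈ T, (q i : ℝ) := prod_pos fun i hi => hq' i (hTP hi)
          push_cast
          field_simp
      _ = H * (1 + A) ^ #P' / (q i₀ * ∏ i ∈ P', (q i : ℝ)) := by
          rw [← sum_mul, ← sum_pow_mul_eq_add_pow]
          simp only [one_pow, one_mul]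
          ring
      _ ≤ A ^ (#P' + 1) / (q i₀ * ∏ i ∈ P', (q i : ℝ)) := by
          gcongr
          exact mul_add_one_pow_le hH0 hHA hA hrle

/-- The probability that each of `r` pairwise coprime integers `q` divides some cycle length is
at most `A ^ r / ∏ q`, as soon as `A` is at least `r` and three times the harmonic number. -/
theorem shapeProb_forall_exists_dvd_le {ι : Type*} [DecidableEq ι] (q : ι → ℕ) {n : ℕ}
    {A : ℝ} (hHA : 3 * ∑ a ∈ Icc 1 n, 1 / (a : ℝ) ≤ A) (hA : 0 < A)
    (P : Finset ι) (hq : ∀ i ∈ P, 0 < q i)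
    (hcop : ∀ i ∈ P, ∀ j ∈ P, i ≠ j → Nat.Coprime (q i) (q j)) (hP : (#P : ℝ) ≤ A) :
    shapeProb n (fun s => ∀ i ∈ P, ∃ a ∈ s, q i ∣ a) ≤ A ^ #P / ∏ i ∈ P, (q i : ℝ) := by
  refine le_trans (shapeExp_mono fun s _ => ?_) (shapeExp_prod_card_filter_dvd_le q
    (sum_nonneg fun _ _ => by positivity) le_rfl hHA hA P hq hcop hP le_rfl)
  split_ifs with h
  · have h1 : ∀ i ∈ P, (1 : ℝ) ≤ ((s.filter (q i ∣ ·)).card : ℝ) := fun i hi => by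
      obtain ⟨a, ha, hd⟩ := h i hi
      exact_mod_cast Multiset.card_pos_iff_exists_mem.2 ⟨a, Multiset.mem_filter.2 ⟨ha, hd⟩⟩
    calc (1 : ℝ) = ∏ i ∈ P, 1 := by simp
      _ ≤ _ := prod_le_prod (fun _ _ => zero_le_one) h1
  · positivity

/-! ### Divisors in short intervals -/

/-- The divisors of `m` that are at most `k`. -/
def smallDivisors (m k : ℕ) : Finset ℕ := {d ∈ m.divisors | d ≤ k}

theorem mem_smallDivisors {m k d : ℕ} : d ∈ smallDivisors m k ↔ (d ∣ m ∧ m ≠ 0) ∧ d ≤ k := by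
  simp [smallDivisors]

theorem nat_mul_shapeProb_forall_dvd_le {m k : ℕ} (hm : m ≠ 0) :
    k * shapeProb k (fun s => ∀ a ∈ s, a ∣ m) ≤ #(smallDivisors m k) := by
  rw [nat_mul_shapeProb]
  calc ∑ a ∈ Icc 1 k, shapeProb (k - a) (fun s => ∀ b ∈ a ::ₘ s, b ∣ m)
      ≤ ∑ a ∈ Icc 1 k, if a ∣ m then (1 : ℝ) else 0 := by
        refine sum_le_sum fun a _ => ?_
        split_ifs with h
        · exact shapeProb_le_one _ _
        · exact (shapeProb_eq_zero fun s _ hs => h (hs a (Multiset.mem_cons_self _ _))).le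
    _ = #{a ∈ Icc 1 k | a ∣ m} := by rw [sum_boole]
    _ ≤ #(smallDivisors m k) := by
        refine Nat.cast_le.2 (card_le_card fun a ha => ?_)
        rw [mem_filter, mem_Icc] at ha
        exact mem_smallDivisors.2 ⟨⟨ha.2, hm⟩, ha.1.2⟩

/-- The divisors of `m` in an interval of length `k` are separated by their least divisors
exceeding `k`, and such a least divisor is a divisor of `m` up to `k` times a prime. -/
theorem card_divisors_Icc_le (m n : ℕ) {k : ℕ} (hk : 0 < k) :
    #{d ∈ m.divisors | d ≤ n ∧ n - d ≤ k} ≤ #(smallDivisors m k) * (#m.primeFactors + 1) := by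
  classical
  -- `e d` is the least divisor of `d` exceeding `k`, or `d` itself if `d ≤ k`.
  let e : ℕ → ℕ := fun d => if h : ∃ c, c ∣ d ∧ k < c then Nat.find h else d
  have he : ∀ d, k < d → e d ∣ d ∧ k < e d ∧ ∀ c, c ∣ d → c < e d → c ≤ k := by
    intro d hd
    have h : ∃ c, c ∣ d ∧ k < c := ⟨d, dvd_rfl, hd⟩
    have h1 : e d = Nat.find h := dif_pos h
    rw [h1]
    refine ⟨(Nat.find_spec h).1, (Nat.find_spec h).2, fun c hc hlt => ?_⟩
    have := Nat.find_min h hlt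
    push Not at this
    exact this hc
  have he' : ∀ d, 0 < d → d ≤ k → e d = d := by
    intro d hd0 hd
    refine dif_neg ?_
    rintro ⟨c, hc, hk⟩
    have := Nat.le_of_dvd hd0 hc
    lia
  rw [show #(smallDivisors m k) * (#m.primeFactors + 1) =
    #(smallDivisors m k ×ˢ insert 1 m.primeFactors) by
      rw [card_product, card_insert_of_notMem]
      exact fun h => Nat.not_prime_one (Nat.prime_of_mem_primeFactors h)]
  refine le_trans (card_le_card_of_injOn e (t :=
    (smallDivisors m k ×ˢ insert 1 m.primeFactors).image fun x => x.1 * x.2) ?_ ?_) card_image_le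
  · intro d hd
    rw [mem_coe, mem_filter, Nat.mem_divisors] at hd
    obtain ⟨⟨hdm, hm⟩, -⟩ := hd
    have hd0 : 0 < d := Nat.pos_of_dvd_of_pos hdm (Nat.pos_of_ne_zero hm)
    rw [mem_coe, mem_image]
    rcases le_or_gt d k with hdk | hdk
    · refine ⟨(d, 1), mem_product.2 ⟨mem_smallDivisors.2 ⟨⟨hdm, hm⟩, hdk⟩, mem_insert_self _ _⟩, ?_⟩
      rw [he' d hd0 hdk, mul_one]
    · obtain ⟨h1, h2, h3⟩ := he d hdk
      have hne : e d ≠ 1 := by lia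
      obtain ⟨p, hp, c, hc⟩ := Nat.exists_prime_and_dvd hne
      have hc0 : 0 < c := Nat.pos_of_ne_zero fun h => by simp [h] at hc; lia
      have hcd : c ∣ d := (Dvd.intro_left p hc.symm).trans h1
      have hlt : c < e d := by rw [hc]; nlinarith [hp.two_le]
      refine ⟨(c, p), mem_product.2 ⟨mem_smallDivisors.2 ⟨⟨hcd.trans hdm, hm⟩, h3 c hcd hlt⟩,
        mem_insert_of_mem ?_⟩, ?_⟩
      · exact Nat.mem_primeFactors.2 ⟨hp, ((Dvd.intro c hc.symm).trans h1).trans hdm, hm⟩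
      · rw [hc, mul_comm]
  · intro d hd d' hd' hdd
    rw [mem_coe, mem_filter, Nat.mem_divisors] at hd hd'
    have hd0 : 0 < d := Nat.pos_of_dvd_of_pos hd.1.1 (Nat.pos_of_ne_zero hd.1.2)
    have hd0' : 0 < d' := Nat.pos_of_dvd_of_pos hd'.1.1 (Nat.pos_of_ne_zero hd.1.2)
    rcases le_or_gt d k with hdk | hdk <;> rcases le_or_gt d' k with hdk' | hdk'
    · rwa [he' d hd0 hdk, he' d' hd0' hdk'] at hdd
    · have := (he d' hdk').2.1
      rw [he' d hd0 hdk] at hdd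
      lia
    · have := (he d hdk).2.1
      rw [he' d' hd0' hdk'] at hdd
      lia
    -- A common divisor exceeding `k` divides the difference of `d` and `d'`, which is at most `k`.
    · obtain ⟨h1, h2, -⟩ := he d hdk
      obtain ⟨h1', -, -⟩ := he d' hdk'
      rw [← hdd] at h1'
      have h3 := Nat.dvd_sub h1 h1'
      have h4 := Nat.dvd_sub h1' h1
      by_contra hne
      rcases lt_or_gt_of_ne hne with h | h
      · have := Nat.le_of_dvd (by lia) h4
        lia
      · have := Nat.le_of_dvd (by lia) h3
        lia

/-! ### Rankin's bound and sums over ranks -/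

/-- The completely multiplicative function `n ↦ n ^ (-1/8)`, vanishing at `0`. -/
noncomputable def rankinWeight : ℕ →* ℝ where
  toFun n := (n : ℝ) ^ (-(1 / 8) : ℝ)
  map_one' := by simp
  map_mul' a b := by
    rw [Nat.cast_mul, Real.mul_rpow (Nat.cast_nonneg a) (Nat.cast_nonneg b)]

theorem rankinWeight_apply (n : ℕ) : rankinWeight n = (n : ℝ) ^ (-(1 / 8) : ℝ) := rfl

theorem rankinWeight_nonneg (n : ℕ) : 0 ≤ rankinWeight n := Real.rpow_nonneg (Nat.cast_nonneg n) _

theorem rankinWeight_le {n : ℕ} (hn : 2 ≤ n) : rankinWeight n ≤ 15 / 16 := by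
  have hn' : (2 : ℝ) ≤ n := by exact_mod_cast hn
  have h0 := rankinWeight_nonneg n
  have h8 : (rankinWeight n) ^ 8 = (n : ℝ)⁻¹ := by
    rw [rankinWeight_apply, ← Real.rpow_natCast, ← Real.rpow_mul (by positivity)]
    norm_num [Real.rpow_neg_one]
  by_contra h
  push Not at h
  have h1 : (15 / 16 : ℝ) ^ 8 < (rankinWeight n) ^ 8 := by gcongr
  have h2 : (n : ℝ)⁻¹ ≤ 2⁻¹ := inv_anti₀ (by norm_num) hn'
  rw [h8] at h1
  norm_num at h1 h2
  linarith

theorem sum_rankinWeight_le (P : Finset ℕ) (hP : ∀ p ∈ P, 0 < p) {v : ℝ} (hv : 0 < v) :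
    ∑ p ∈ P, rankinWeight p ≤ v ^ 8 + #P / v := by
  have h1 : ∀ p ∈ P, rankinWeight p ≤ (if (p : ℝ) ≤ v ^ 8 then 1 else 0) + 1 / v := by
    intro p hp
    have hp1 : (1 : ℝ) ≤ p := by exact_mod_cast hP p hp
    have hv' : 0 < 1 / v := by positivity
    rw [rankinWeight_apply]
    split_ifs with h
    · have := Real.rpow_le_one_of_one_le_of_nonpos hp1 (show (-(1 / 8) : ℝ) ≤ 0 by norm_num)
      linarith
    · push Not at h
      have h2 := Real.rpow_le_rpow_of_nonpos (by positivity) h.le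
        (show (-(1 / 8) : ℝ) ≤ 0 by norm_num)
      rw [← Real.rpow_natCast v 8, ← Real.rpow_mul hv.le] at h2
      norm_num [Real.rpow_neg_one] at h2
      rw [zero_add, one_div]
      norm_num
      exact h2
  refine (sum_le_sum h1).trans ?_
  rw [sum_add_distrib, sum_const, nsmul_eq_mul, sum_boole, mul_one_div]
  gcongr
  have hsub : P.filter (fun p : ℕ => (p : ℝ) ≤ v ^ 8) ⊆ Icc 1 ⌊v ^ 8⌋₊ := by
    intro p hp
    rw [mem_filter] at hp
    exact mem_Icc.2 ⟨hP p hp.1, Nat.le_floor hp.2⟩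
  calc ((#(P.filter fun p : ℕ => (p : ℝ) ≤ v ^ 8) : ℕ) : ℝ) ≤ (⌊v ^ 8⌋₊ : ℝ) := by
        have := card_le_card hsub
        rw [Nat.card_Icc, Nat.add_sub_cancel] at this
        exact_mod_cast this
    _ ≤ v ^ 8 := Nat.floor_le (by positivity)

theorem inv_one_sub_le_exp {x : ℝ} (h0 : 0 ≤ x) (h1 : x ≤ 15 / 16) :
    (1 - x)⁻¹ ≤ Real.exp (16 * x) := by
  have hpos : 0 < 1 - x := by linarith
  calc (1 - x)⁻¹ ≤ 16 * x + 1 := by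
        rw [inv_le_iff_one_le_mul₀ hpos]
        nlinarith
    _ ≤ _ := Real.add_one_le_exp _

/-- Rankin's bound for the number of divisors of `m` up to `k`, in terms of the number of prime
factors of `m`. The parameter `v` splits the prime factors at `v ^ 8`. -/
theorem card_smallDivisors_le {m k : ℕ} (hk : 0 < k) {v : ℝ} (hv : 0 < v) :
    (#(smallDivisors m k) : ℝ) ≤
      Real.exp (Real.log k / 8) * Real.exp (16 * (v ^ 8 + #m.primeFactors / v)) := by
  have hk' : (0 : ℝ) < k := by exact_mod_cast hk
  have hlt : ∀ {p : ℕ}, p.Prime → ‖rankinWeight p‖ < 1 := fun {p} hp => by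
    rw [Real.norm_of_nonneg (rankinWeight_nonneg p)]
    linarith [rankinWeight_le hp.two_le]
  obtain ⟨-, hsum⟩ :=
    EulerProduct.summable_and_hasSum_factoredNumbers_prod_filter_prime_geometric hlt m.primeFactors
  have hfilter : m.primeFactors.filter Nat.Prime = m.primeFactors :=
    filter_true_of_mem fun p hp => Nat.prime_of_mem_primeFactors hp
  rw [hfilter] at hsum
  have hsum' : ∑ d ∈ smallDivisors m k, rankinWeight d ≤
      ∏ p ∈ m.primeFactors, (1 - rankinWeight p)⁻¹ := by
    have hmem : ∀ d ∈ smallDivisors m k, d ∈ Nat.factoredNumbers m.primeFactors := by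
      intro d hd
      obtain ⟨⟨h1, h2⟩, -⟩ := mem_smallDivisors.1 hd
      refine Nat.mem_factoredNumbers_iff_primeFactors_subset.2
        ⟨fun h => h2 (Nat.eq_zero_of_zero_dvd (h ▸ h1)), Nat.primeFactors_mono h1 h2⟩
    have h := sum_le_hasSum ((smallDivisors m k).subtype (· ∈ Nat.factoredNumbers m.primeFactors))
      (fun i _ => rankinWeight_nonneg i) hsum
    rwa [sum_subtype_of_mem (fun d => rankinWeight d) hmem] at h
  have hprod : ∏ p ∈ m.primeFactors, (1 - rankinWeight p)⁻¹ ≤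
      Real.exp (16 * (v ^ 8 + #m.primeFactors / v)) := by
    calc ∏ p ∈ m.primeFactors, (1 - rankinWeight p)⁻¹
        ≤ ∏ p ∈ m.primeFactors, Real.exp (16 * rankinWeight p) := by
          refine prod_le_prod (fun p hp => ?_) fun p hp => ?_
          · have := rankinWeight_le (Nat.prime_of_mem_primeFactors hp).two_le
            exact inv_nonneg.2 (by linarith)
          · exact inv_one_sub_le_exp (rankinWeight_nonneg p)
              (rankinWeight_le (Nat.prime_of_mem_primeFactors hp).two_le)
      _ = Real.exp (16 * ∑ p ∈ m.primeFactors, rankinWeight p) := by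
          rw [← Real.exp_sum, mul_sum]
      _ ≤ _ := by
          gcongr
          exact sum_rankinWeight_le _ (fun p hp => (Nat.prime_of_mem_primeFactors hp).pos) hv
  calc (#(smallDivisors m k) : ℝ) = ∑ d ∈ smallDivisors m k, 1 := by simp
    _ ≤ ∑ d ∈ smallDivisors m k, Real.exp (Real.log k / 8) * rankinWeight d := by
        refine sum_le_sum fun d hd => ?_
        obtain ⟨⟨h1, h2⟩, h3⟩ := mem_smallDivisors.1 hd
        have hd0 : (0 : ℝ) < d := by
          exact_mod_cast Nat.pos_of_dvd_of_pos h1 (Nat.pos_of_ne_zero h2)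
        rw [rankinWeight_apply, Real.rpow_def_of_pos hd0, ← Real.exp_add]
        refine Real.one_le_exp ?_
        have := Real.log_le_log hd0 (Nat.cast_le.2 h3)
        linarith
    _ = Real.exp (Real.log k / 8) * ∑ d ∈ smallDivisors m k, rankinWeight d := by rw [mul_sum]
    _ ≤ _ := by
        gcongr
        exact hsum'.trans hprod

theorem sum_Icc_inv_sq_le (N : ℕ) : ∑ i ∈ Icc 1 N, 1 / (i : ℝ) ^ 2 ≤ 2 - 1 / (N : ℝ) := by
  induction N with
  | zero => norm_num
  | succ N ih =>
    rw [sum_Icc_succ_top (by lia)]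
    rcases Nat.eq_zero_or_pos N with rfl | hN
    · norm_num
    have hN' : (0 : ℝ) < N := by exact_mod_cast hN
    push_cast
    have h1 : 1 / ((N : ℝ) + 1) ^ 2 ≤ 1 / N - 1 / (N + 1) := by
      rw [div_sub_div _ _ (by positivity) (by positivity), div_le_div_iff₀ (by positivity)
        (by positivity)]
      nlinarith
    linarith

/-- In a finite set of natural numbers, the inverse squares of the ranks of the elements add up to
at most `2`. -/
theorem sum_inv_sq_rank_le (S : Finset ℕ) :
    ∑ x ∈ S, 1 / (#{y ∈ S | y ≤ x} : ℝ) ^ 2 ≤ 2 := by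
  have h : ∑ x ∈ S, 1 / (#{y ∈ S | y ≤ x} : ℝ) ^ 2 = ∑ i ∈ Icc 1 #S, 1 / (i : ℝ) ^ 2 := by
    induction S using Finset.induction_on_max with
    | empty => simp
    | insert a S ha ih =>
      have hna : a ∉ S := fun h => lt_irrefl _ (ha a h)
      rw [sum_insert hna, card_insert_of_notMem hna, sum_Icc_succ_top (by lia), ← ih, add_comm]
      congr 1
      · refine sum_congr rfl fun x hx => ?_
        rw [filter_insert, if_neg (by have := ha x hx; lia)]
      · rw [filter_true_of_mem, card_insert_of_notMem hna]
        intro y hy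
        rcases mem_insert.1 hy with rfl | hy
        · exact le_rfl
        · exact (ha y hy).le
  rw [h]
  refine (sum_Icc_inv_sq_le _).trans ?_
  have : (0 : ℝ) ≤ 1 / (#S : ℝ) := by positivity
  linarith

/-! ### The contribution of each defect -/

/-- The largest power of `p` dividing `m` (for `p` prime and `m ≠ 0`). -/
def primePart (m p : ℕ) : ℕ := p ^ m.factorization p

theorem primePart_pos {m p : ℕ} (hp : p ∈ m.primeFactors) : 0 < primePart m p :=
  pow_pos (Nat.prime_of_mem_primeFactors hp).pos _

theorem le_primePart {m p : ℕ} (hp : p ∈ m.primeFactors) : p ≤ primePart m p := by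
  have hp' := Nat.mem_primeFactors.1 hp
  exact Nat.le_self_pow (hp'.1.factorization_pos_of_dvd hp'.2.2 hp'.2.1).ne' p

theorem two_le_primePart {m p : ℕ} (hp : p ∈ m.primeFactors) : 2 ≤ primePart m p :=
  (Nat.prime_of_mem_primeFactors hp).two_le.trans (le_primePart hp)

theorem primePart_dvd (m p : ℕ) : primePart m p ∣ m := Nat.ordProj_dvd m p

theorem coprime_primePart {m p p' : ℕ} (hp : p ∈ m.primeFactors) (hp' : p' ∈ m.primeFactors)
    (h : p ≠ p') : (primePart m p).Coprime (primePart m p') :=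
  Nat.Coprime.pow _ _ ((Nat.coprime_primes (Nat.prime_of_mem_primeFactors hp)
    (Nat.prime_of_mem_primeFactors hp')).2 h)

theorem pow_dvd_or_pow_dvd_of_dvd_lcm {p j a b : ℕ} (hp : p.Prime) (h : p ^ j ∣ Nat.lcm a b) :
    p ^ j ∣ a ∨ p ^ j ∣ b := by
  rcases eq_or_ne a 0 with rfl | ha
  · exact Or.inl (dvd_zero _)
  rcases eq_or_ne b 0 with rfl | hb
  · exact Or.inr (dvd_zero _)
  rw [hp.pow_dvd_iff_le_factorization (Nat.lcm_ne_zero ha hb), Nat.factorization_lcm ha hb,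
    Finsupp.sup_apply, le_sup_iff] at h
  rwa [hp.pow_dvd_iff_le_factorization ha, hp.pow_dvd_iff_le_factorization hb]

theorem exists_mem_primePart_dvd {m p : ℕ} (hp : p ∈ m.primeFactors) {s : Multiset ℕ}
    (h : primePart m p ∣ s.lcm) : ∃ a ∈ s, primePart m p ∣ a := by
  induction s using Multiset.induction_on with
  | empty =>
    rw [Multiset.lcm_zero, Nat.dvd_one] at h
    have := two_le_primePart hp
    lia
  | cons a s ih =>
    rw [Multiset.lcm_cons] at h
    rcases pow_dvd_or_pow_dvd_of_dvd_lcm (Nat.prime_of_mem_primeFactors hp) h with h | h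
    · exact ⟨a, Multiset.mem_cons_self _ _, h⟩
    · obtain ⟨b, hb, hd⟩ := ih h
      exact ⟨b, Multiset.mem_cons_of_mem hb, hd⟩

/-- The primes `p` for which `d` does not contain the full power of `p` in `m`. -/
def deficientPrimes (m d : ℕ) : Finset ℕ := {p ∈ m.primeFactors | ¬ primePart m p ∣ d}

theorem deficientPrimes_subset (m d : ℕ) : deficientPrimes m d ⊆ m.primeFactors := filter_subset _ _

theorem le_mul_prod_deficientPrimes {m d : ℕ} (hm : m ≠ 0) (hd : 0 < d) :
    m ≤ d * ∏ p ∈ deficientPrimes m d, primePart m p := by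
  have h1 : ∏ p ∈ m.primeFactors, primePart m p = m := by
    exact Nat.prod_factorization_pow_eq_self hm
  conv_lhs => rw [← h1, ← prod_filter_mul_prod_filter_not _ (fun p => primePart m p ∣ d)]
  refine Nat.mul_le_mul_right _ (Nat.le_of_dvd hd ?_)
  refine Finset.prod_dvd_of_isRelPrime (fun p hp p' hp' hne => ?_) fun p hp => (mem_filter.1 hp).2
  exact Nat.coprime_iff_isRelPrime.1 (coprime_primePart (mem_filter.1 hp).1 (mem_filter.1 hp').1 hne)

theorem deficientPrimes_nonempty {m d : ℕ} (hm : m ≠ 0) (hdm : d ∣ m) (hne : m ≠ d) :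
    (deficientPrimes m d).Nonempty := by
  have hd : 0 < d := Nat.pos_of_dvd_of_pos hdm (Nat.pos_of_ne_zero hm)
  rw [nonempty_iff_ne_empty]
  intro h
  have h1 := le_mul_prod_deficientPrimes hm hd
  rw [h, prod_empty, mul_one] at h1
  exact hne (le_antisymm h1 (Nat.le_of_dvd (Nat.pos_of_ne_zero hm) hdm))

/-- The probability that a random permutation of `n` points has order `m`, given that the cycle of
a fixed point leaves `k` points out. -/
noncomputable def defectProb (n m k : ℕ) : ℝ :=
  shapeProb k (fun s => ((n - k) ::ₘ s).lcm = m)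

theorem defectProb_nonneg (n m k : ℕ) : 0 ≤ defectProb n m k := shapeProb_nonneg _ _

theorem defectProb_le_one (n m k : ℕ) : defectProb n m k ≤ 1 := shapeProb_le_one _ _

/-- The defects `k` that contribute to the probability of order `m`. -/
def dvdDefects (n m : ℕ) : Finset ℕ := {k ∈ range n | (n - k) ∣ m}

theorem nat_mul_orderProb (n m : ℕ) :
    n * orderProb n m = ∑ k ∈ dvdDefects n m, defectProb n m k := by
  rw [orderProb_eq_shapeProb, nat_mul_shapeProb, dvdDefects, sum_filter]
  refine sum_bij' (fun a _ => n - a) (fun k _ => n - k) ?_ ?_ ?_ ?_ ?_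
  · intro a ha
    rw [mem_Icc] at ha
    exact mem_range.2 (by lia)
  · intro k hk
    rw [mem_range] at hk
    exact mem_Icc.2 (by lia)
  · intro a ha
    rw [mem_Icc] at ha
    exact Nat.sub_sub_self ha.2
  · intro k hk
    rw [mem_range] at hk
    exact Nat.sub_sub_self hk.le
  · intro a ha
    rw [mem_Icc] at ha
    rw [Nat.sub_sub_self ha.2]
    split_ifs with h
    · rw [defectProb, Nat.sub_sub_self ha.2]
    · refine shapeProb_eq_zero fun s _ hs => h (hs ▸ Multiset.dvd_lcm (Multiset.mem_cons_self _ _))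

theorem defectProb_le_forall_dvd (n m k : ℕ) :
    defectProb n m k ≤ shapeProb k (fun s => ∀ a ∈ s, a ∣ m) :=
  shapeProb_mono fun _ _ hs _ ha => hs ▸ Multiset.dvd_lcm (Multiset.mem_cons_of_mem ha)

theorem defectProb_le_deficient (n m k : ℕ) :
    defectProb n m k ≤
      shapeProb k (fun s => ∀ p ∈ deficientPrimes m (n - k), ∃ a ∈ s, primePart m p ∣ a) := by
  refine shapeProb_mono fun s _ hs p hp => ?_
  obtain ⟨hp1, hp2⟩ := mem_filter.1 hp
  obtain ⟨a, ha, hd⟩ := exists_mem_primePart_dvd hp1 (s := (n - k) ::ₘ s)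
    (hs ▸ primePart_dvd m p)
  rcases Multiset.mem_cons.1 ha with rfl | ha
  · exact absurd hd hp2
  · exact ⟨a, ha, hd⟩

theorem orderProb_le_forall_exists (n m : ℕ) :
    orderProb n m ≤ shapeProb n (fun s => ∀ p ∈ m.primeFactors, ∃ a ∈ s, primePart m p ∣ a) := by
  rw [orderProb_eq_shapeProb]
  exact shapeProb_mono fun s _ hs p hp => exists_mem_primePart_dvd hp (hs ▸ primePart_dvd m p)

theorem nat_mul_shapeProb_le_sub_one {k a : ℕ} {p : Multiset ℕ → Prop} (ha : a ∈ Icc 1 k)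
    (h : ∀ s ∈ cycleShapes (k - a), ¬ p (a ::ₘ s)) : k * shapeProb k p ≤ k - 1 := by
  rw [nat_mul_shapeProb, ← sum_erase (a := a) _ (shapeProb_eq_zero h)]
  calc ∑ b ∈ (Icc 1 k).erase a, shapeProb (k - b) (fun s => p (b ::ₘ s))
      ≤ ∑ b ∈ (Icc 1 k).erase a, 1 := sum_le_sum fun b _ => shapeProb_le_one _ _
    _ = k - 1 := by
        have := mem_Icc.1 ha
        rw [sum_const, card_erase_of_mem ha, Nat.card_Icc, nsmul_eq_mul, Nat.add_sub_cancel,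
          Nat.cast_sub (by lia)]
        simp

theorem eq_one_of_mem_cycleShapes_one {s : Multiset ℕ} (hs : s ∈ cycleShapes 1) {a : ℕ}
    (ha : a ∈ s) : a = 1 := by
  obtain ⟨h1, h2⟩ := mem_cycleShapes.1 hs
  have := h1 a ha
  have := Multiset.le_sum_of_mem ha
  lia

/-- Unless `m = n - k` is divisible by all of `1, …, k`, a positive proportion at least `1 / k` of
the permutations of the `k` remaining points is excluded: those in which a given point lies in a
cycle of a suitable length, which is a non-divisor of `m`, or `k`, or `k - 1`. -/
theorem defectProb_eq_zero_or_le {n m k : ℕ} (hm : m ≠ 0) (hdm : (n - k) ∣ m)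
    (h : ¬ (m = n - k ∧ (Icc 1 k).lcm id ∣ m)) :
    defectProb n m k = 0 ∨ (1 ≤ k ∧ k * defectProb n m k ≤ k - 1) := by
  by_cases hl : (Icc 1 k).lcm id ∣ m
  · have hne : m ≠ n - k := fun h' => h ⟨h', hl⟩
    obtain ⟨p, hp⟩ := deficientPrimes_nonempty hm hdm hne
    obtain ⟨hp1, hp2⟩ := mem_filter.1 hp
    have hq := two_le_primePart hp1
    have key : ∀ s : Multiset ℕ, (∀ a ∈ s, ¬ primePart m p ∣ a) → ((n - k) ::ₘ s).lcm ≠ m := by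
      intro s hs hlcm
      obtain ⟨a, ha, hd⟩ := exists_mem_primePart_dvd hp1 (s := (n - k) ::ₘ s)
        (hlcm.symm ▸ primePart_dvd m p)
      rcases Multiset.mem_cons.1 ha with rfl | ha
      · exact hp2 hd
      · exact hs a ha hd
    rcases Nat.eq_zero_or_pos k with rfl | hk
    · left
      refine shapeProb_eq_zero fun s hs => key s fun a ha => ?_
      rw [cycleShapes_zero, mem_singleton] at hs
      simp [hs] at ha
    · right
      refine ⟨hk, ?_⟩
      by_cases hqk : primePart m p ∣ k
      · have hk2 : 2 ≤ k := hq.trans (Nat.le_of_dvd hk hqk)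
        refine nat_mul_shapeProb_le_sub_one (a := k - 1) (mem_Icc.2 (by lia)) fun s hs => key _ ?_
        rw [Nat.sub_sub_self hk] at hs
        intro a ha hd
        rcases Multiset.mem_cons.1 ha with rfl | ha
        · have := Nat.dvd_sub hqk hd
          rw [Nat.sub_sub_self hk, Nat.dvd_one] at this
          lia
        · rw [eq_one_of_mem_cycleShapes_one hs ha, Nat.dvd_one] at hd
          lia
      · refine nat_mul_shapeProb_le_sub_one (a := k) (mem_Icc.2 (by lia)) fun s hs => key _ ?_
        rw [Nat.sub_self, cycleShapes_zero, mem_singleton] at hs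
        intro a ha hd
        rw [hs, Multiset.mem_cons] at ha
        rcases ha with rfl | ha
        · exact hqk hd
        · simp at ha
  · right
    rw [Finset.lcm_dvd_iff] at hl
    push Not at hl
    obtain ⟨a, ha, hna⟩ := hl
    have := mem_Icc.1 ha
    refine ⟨by lia, nat_mul_shapeProb_le_sub_one ha fun s _ hs => hna ?_⟩
    rw [← hs]
    exact Multiset.dvd_lcm (Multiset.mem_cons_of_mem (Multiset.mem_cons_self _ _))

/-- If at least `R` of the prime powers exactly dividing `m` exceed `A u`, then the probability
that all of them divide a cycle length is at most `u ^ (-R)`. -/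
theorem shapeProb_primePart_le {m k R : ℕ} {A u : ℝ}
    (hHA : 3 * ∑ a ∈ Icc 1 k, 1 / (a : ℝ) ≤ A) (hA : 0 < A) (hu : 0 < u) {P : Finset ℕ}
    (hPm : P ⊆ m.primeFactors) (hP : ∀ p ∈ P, A * u ≤ primePart m p) (hRP : R ≤ #P)
    (hR : (R : ℝ) ≤ A) :
    shapeProb k (fun s => ∀ p ∈ P, ∃ a ∈ s, primePart m p ∣ a) ≤ (1 / u) ^ R := by
  obtain ⟨Q, hQP, hQ⟩ := exists_subset_card_eq hRP
  calc shapeProb k (fun s => ∀ p ∈ P, ∃ a ∈ s, primePart m p ∣ a)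
      ≤ shapeProb k (fun s => ∀ p ∈ Q, ∃ a ∈ s, primePart m p ∣ a) :=
        shapeProb_mono fun s _ h p hp => h p (hQP hp)
    _ ≤ A ^ #Q / ∏ p ∈ Q, (primePart m p : ℝ) :=
        shapeProb_forall_exists_dvd_le _ hHA hA Q (fun p hp => primePart_pos (hPm (hQP hp)))
          (fun p hp p' hp' hne => coprime_primePart (hPm (hQP hp)) (hPm (hQP hp')) hne)
          (by rw [hQ]; exact hR)
    _ ≤ A ^ #Q / ∏ p ∈ Q, (A * u) := by
        have : 0 < ∏ p ∈ Q, (A * u) := prod_pos fun _ _ => by positivity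
        gcongr with p hp
        exact hP p (hQP hp)
    _ = (1 / u) ^ R := by
        rw [prod_const, hQ, ← div_pow]
        congr 1
        field_simp

theorem card_le_of_forall_primePart_le {m : ℕ} {P : Finset ℕ} (hPm : P ⊆ m.primeFactors) {x : ℝ}
    (hx : 0 ≤ x) (h : ∀ p ∈ P, (primePart m p : ℝ) ≤ x) : (#P : ℝ) ≤ x := by
  have hsub : P ⊆ Icc 1 ⌊x⌋₊ := fun p hp => mem_Icc.2
    ⟨(Nat.prime_of_mem_primeFactors (hPm hp)).pos, Nat.le_floor
      (le_trans (Nat.cast_le.2 (le_primePart (hPm hp))) (h p hp))⟩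
  have h1 := card_le_card hsub
  rw [Nat.card_Icc, Nat.add_sub_cancel] at h1
  exact (Nat.cast_le.2 h1).trans (Nat.floor_le hx)

theorem sum_Icc_inv_le_one_add_log (k : ℕ) : ∑ a ∈ Icc 1 k, 1 / (a : ℝ) ≤ 1 + Real.log k := by
  have h := harmonic_le_one_add_log k
  rw [harmonic_eq_sum_Icc] at h
  push_cast at h
  simpa only [one_div] using h

/-- Two contributing defects that are both small force `m` to be large. -/
theorem mul_sub_le_mul_of_mem_dvdDefects {n m k k' : ℕ} (hm : m ≠ 0) (hk : k ∈ dvdDefects n m)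
    (hk' : k' ∈ dvdDefects n m) (hne : k ≠ k') : (n - k) * (n - k') ≤ max k k' * m := by
  obtain ⟨h1, h2⟩ := mem_filter.1 hk
  obtain ⟨h1', h2'⟩ := mem_filter.1 hk'
  rw [mem_range] at h1 h1'
  rw [← Nat.gcd_mul_lcm (n - k) (n - k')]
  refine Nat.mul_le_mul ?_ (Nat.le_of_dvd (Nat.pos_of_ne_zero hm) (Nat.lcm_dvd h2 h2'))
  have hg1 := Nat.gcd_dvd_left (n - k) (n - k')
  have hg2 := Nat.gcd_dvd_right (n - k) (n - k')
  rcases lt_or_gt_of_ne hne with h | h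
  · have := Nat.le_of_dvd (by lia) (Nat.dvd_sub hg1 hg2)
    lia
  · have := Nat.le_of_dvd (by lia) (Nat.dvd_sub hg2 hg1)
    lia

theorem card_dvdDefects_le {n m k : ℕ} (hm : m ≠ 0) (hk : 0 < k) :
    #{j ∈ dvdDefects n m | j ≤ k} ≤ #(smallDivisors m k) * (#m.primeFactors + 1) := by
  refine le_trans (card_le_card_of_injOn (n - ·) ?_ ?_) (card_divisors_Icc_le m n hk)
  · intro j hj
    simp only [dvdDefects, coe_filter, mem_filter, mem_range, Set.mem_ofPred_eq,
      Nat.mem_divisors] at hj ⊢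
    exact ⟨⟨hj.1.2, hm⟩, by lia, by lia⟩
  · intro j hj j' hj' h
    simp only [dvdDefects, coe_filter, mem_filter, mem_range, Set.mem_ofPred_eq] at hj hj' h
    lia

/-! ### Estimates in the scale of the logarithm -/

theorem one_div_pow_floor_le {u : ℝ} (hu : 1000 ≤ u) (j : ℕ) :
    (1 / u) ^ ⌊u ^ j⌋₊ ≤ Real.exp (1 - u ^ j) := by
  have h1 : 1 / u ≤ Real.exp (-1) := by
    rw [Real.exp_neg, one_div]
    exact inv_anti₀ (Real.exp_pos _) (by linarith [Real.exp_one_lt_d9])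
  calc (1 / u) ^ ⌊u ^ j⌋₊ ≤ (Real.exp (-1)) ^ ⌊u ^ j⌋₊ :=
        pow_le_pow_left₀ (by positivity) h1 _
    _ = Real.exp (-(⌊u ^ j⌋₊ : ℝ)) := by rw [← Real.exp_nat_mul]; ring_nf
    _ ≤ Real.exp (1 - u ^ j) := by
        apply Real.exp_le_exp.2
        linarith [Nat.lt_floor_add_one (u ^ j)]

theorem pow_pow_le_exp {u : ℝ} (hu : 0 ≤ u) (a j : ℕ) : (u ^ a) ^ j ≤ Real.exp (a * u * j) := by
  rw [← pow_mul]
  calc u ^ (a * j) ≤ (Real.exp u) ^ (a * j) :=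
        pow_le_pow_left₀ hu (by linarith [Real.add_one_le_exp u]) _
    _ = Real.exp (a * u * j) := by rw [← Real.exp_nat_mul]; push_cast; ring_nf

theorem eq_exp_of_log_eq {n : ℕ} {u : ℝ} (hu : 1000 ≤ u) (hn : Real.log n = u ^ 64) :
    (n : ℝ) = Real.exp (u ^ 64) := by
  rw [← hn, Real.exp_log]
  rcases Nat.eq_zero_or_pos n with rfl | h
  · have : 0 < u ^ 64 := by positivity
    simp at hn
    linarith
  · exact_mod_cast h

/-- An order exactly divisible by many large prime powers is very unlikely. -/
theorem nat_mul_orderProb_le_of_many {n m : ℕ} {u : ℝ} (hu : 1000 ≤ u)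
    (hn : Real.log n = u ^ 64)
    (hR : ⌊u ^ 65⌋₊ ≤ #{p ∈ m.primeFactors | u ^ 66 ≤ primePart m p}) :
    n * orderProb n m ≤ Real.exp (-u ^ 64) := by
  have h64 : 1 ≤ u ^ 64 := one_le_pow₀ (by linarith)
  have h65 : u ^ 65 = u * u ^ 64 := by ring
  have hH : 3 * ∑ a ∈ Icc 1 n, 1 / (a : ℝ) ≤ u ^ 65 := by
    have := sum_Icc_inv_le_one_add_log n
    rw [hn] at this
    nlinarith
  have h1 : orderProb n m ≤ Real.exp (1 - u ^ 65) := by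
    refine (orderProb_le_forall_exists n m).trans (le_trans ?_ (one_div_pow_floor_le hu 65))
    refine le_trans (shapeProb_mono fun s _ hs p hp => ?_) (shapeProb_primePart_le hH (by positivity)
      (by positivity) (filter_subset (fun p => u ^ 66 ≤ primePart m p) m.primeFactors)
      (fun p hp => ?_) hR (Nat.floor_le (by positivity)))
    · exact hs p (mem_filter.1 hp).1
    · refine le_of_eq_of_le ?_ (mem_filter.1 hp).2
      ring
  rw [eq_exp_of_log_eq hu hn]
  calc Real.exp (u ^ 64) * orderProb n m ≤ Real.exp (u ^ 64) * Real.exp (1 - u ^ 65) := by gcongr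
    _ = Real.exp (u ^ 64 + (1 - u ^ 65)) := by rw [Real.exp_add]
    _ ≤ Real.exp (-u ^ 64) := by
        apply Real.exp_le_exp.2
        nlinarith

theorem card_primeFactors_le {m : ℕ} {u : ℝ} (hu : 1000 ≤ u)
    (hR : #{p ∈ m.primeFactors | u ^ 66 ≤ primePart m p} < ⌊u ^ 65⌋₊) :
    (#m.primeFactors : ℝ) ≤ 2 * u ^ 66 := by
  have h1 : (#{p ∈ m.primeFactors | u ^ 66 ≤ primePart m p} : ℝ) ≤ u ^ 65 :=
    (Nat.cast_le.2 hR.le).trans (Nat.floor_le (by positivity))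
  have h2 : (#{p ∈ m.primeFactors | ¬ u ^ 66 ≤ primePart m p} : ℝ) ≤ u ^ 66 :=
    card_le_of_forall_primePart_le (filter_subset _ _) (by positivity) fun p hp =>
      (not_le.1 (mem_filter.1 hp).2).le
  have h3 : u ^ 65 ≤ u ^ 66 := pow_le_pow_right₀ (by linarith) (by norm_num)
  rw [← card_filter_add_card_filter_not (s := m.primeFactors)
    (fun p => u ^ 66 ≤ (primePart m p : ℝ))]
  push_cast
  linarith

theorem card_smallDivisors_le_exp {m k : ℕ} {u : ℝ} (hu : 1000 ≤ u) (hk : 0 < k)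
    (hω : (#m.primeFactors : ℝ) ≤ 2 * u ^ 66) (hlog : u ^ 60 ≤ Real.log k) :
    (#(smallDivisors m k) : ℝ) ≤ Real.exp (3 / 16 * Real.log k) := by
  refine (card_smallDivisors_le hk (show 0 < u ^ 7 by positivity)).trans ?_
  rw [← Real.exp_add]
  apply Real.exp_le_exp.2
  have h1 : #m.primeFactors / u ^ 7 ≤ 2 * u ^ 59 := by
    rw [div_le_iff₀ (by positivity)]
    linarith [show 2 * u ^ 59 * u ^ 7 = 2 * u ^ 66 by ring]
  have h2 : (u ^ 7) ^ 8 ≤ u ^ 59 := by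
    rw [← pow_mul]
    exact pow_le_pow_right₀ (by linarith) (by norm_num)
  have h3 : u ^ 60 = u * u ^ 59 := by ring
  have h4 : 0 < u ^ 59 := by positivity
  nlinarith

theorem card_primeFactors_add_one_le_exp {m k : ℕ} {u : ℝ} (hu : 1000 ≤ u)
    (hω : (#m.primeFactors : ℝ) ≤ 2 * u ^ 66) (hlog : u ^ 60 ≤ Real.log k) :
    (#m.primeFactors : ℝ) + 1 ≤ Real.exp (1 / 16 * Real.log k) := by
  have h1 : (1 : ℝ) ≤ u ^ 66 := one_le_pow₀ (by linarith)
  have h2 : u ^ 67 ≤ Real.exp (67 * u) := by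
    simpa using pow_pow_le_exp (show 0 ≤ u by linarith) 67 1
  have h3 : u ^ 67 = u * u ^ 66 := by ring
  have h4 : u ^ 3 ≤ u ^ 60 := pow_le_pow_right₀ (by linarith) (by norm_num)
  calc (#m.primeFactors : ℝ) + 1 ≤ u ^ 67 := by nlinarith
    _ ≤ Real.exp (67 * u) := h2
    _ ≤ Real.exp (1 / 16 * Real.log k) := by
        apply Real.exp_le_exp.2
        have h5 : 1000 ^ 2 * u ≤ u ^ 2 * u := by gcongr
        have h6 : u ^ 3 = u ^ 2 * u := by ring
        linarith

/-- When `m` has few prime factors, large defects contribute little: a defect `k` contributes at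
most `k ^ (-13/16)`, while its rank among the contributing defects is at most `k ^ (1/4)`. -/
theorem sum_defectProb_le {n m : ℕ} {u x : ℝ} (hm : m ≠ 0) (hu : 1000 ≤ u)
    (hω : (#m.primeFactors : ℝ) ≤ 2 * u ^ 66) (hx : u ^ 60 ≤ x) {S : Finset ℕ}
    (hS : S ⊆ dvdDefects n m) (hSx : ∀ k ∈ S, Real.exp x ≤ k) :
    ∑ k ∈ S, defectProb n m k ≤ 2 * Real.exp (-x / 4) := by
  have hterm : ∀ k ∈ S, defectProb n m k ≤
      Real.exp (-x / 4) * (1 / (#{j ∈ S | j ≤ k} : ℝ) ^ 2) := by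
    intro k hk
    have hk0' : (0 : ℝ) < k := (Real.exp_pos _).trans_le (hSx k hk)
    have hk0 : 0 < k := by exact_mod_cast hk0'
    have hxl : x ≤ Real.log k := (Real.le_log_iff_exp_le hk0').2 (hSx k hk)
    have hD := card_smallDivisors_le_exp hu hk0 hω (hx.trans hxl)
    have hrank : (#{j ∈ S | j ≤ k} : ℝ) ≤ Real.exp (1 / 4 * Real.log k) := by
      calc (#{j ∈ S | j ≤ k} : ℝ) ≤ (#(smallDivisors m k) * (#m.primeFactors + 1) : ℕ) := by
            refine Nat.cast_le.2 (le_trans (card_le_card ?_) (card_dvdDefects_le (n := n) hm hk0))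
            exact filter_subset_filter _ hS
        _ ≤ Real.exp (3 / 16 * Real.log k) * Real.exp (1 / 16 * Real.log k) := by
            push_cast
            exact mul_le_mul hD (card_primeFactors_add_one_le_exp hu hω (hx.trans hxl))
              (by positivity) (by positivity)
        _ = Real.exp (1 / 4 * Real.log k) := by rw [← Real.exp_add]; ring_nf
    have hpos : (0 : ℝ) < #{j ∈ S | j ≤ k} :=
      Nat.cast_pos.2 (card_pos.2 ⟨k, mem_filter.2 ⟨hk, le_rfl⟩⟩)
    have hA : defectProb n m k ≤ Real.exp (-(13 / 16) * Real.log k) := by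
      refine (defectProb_le_forall_dvd n m k).trans ?_
      have h := (nat_mul_shapeProb_forall_dvd_le (k := k) hm).trans hD
      rw [mul_comm, ← le_div_iff₀ hk0'] at h
      refine h.trans (le_of_eq ?_)
      conv_lhs => rw [← Real.exp_log hk0', Real.log_exp]
      rw [← Real.exp_sub]
      ring_nf
    have hx0 : 0 ≤ x := le_trans (by positivity) hx
    calc defectProb n m k ≤ Real.exp (-(13 / 16) * Real.log k) := hA
      _ ≤ Real.exp (-x / 4) * (1 / (Real.exp (1 / 4 * Real.log k)) ^ 2) := by
          rw [← Real.exp_nat_mul, one_div, ← Real.exp_neg, ← Real.exp_add]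
          apply Real.exp_le_exp.2
          push_cast
          linarith
      _ ≤ _ := by gcongr
  refine (sum_le_sum hterm).trans ?_
  rw [← mul_sum, mul_comm]
  have := sum_inv_sq_rank_le S
  gcongr

/-- If `m` is large compared with the cycle of length `n - k`, then the prime powers of `m` missing
in `n - k` are unlikely to all divide cycle lengths of a permutation of the `k` other points. -/
theorem defectProb_le_exp_of_large {n m k : ℕ} {u : ℝ} (hu : 1000 ≤ u) (hm : m ≠ 0)
    (hkn : k < n) (hk : (k : ℝ) < Real.exp (u ^ 60))
    (hlarge : (n - k : ℕ) * Real.exp (u ^ 64 / 2) ≤ m) :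
    defectProb n m k ≤ Real.exp (-(2 * u ^ 60)) := by
  have h60 : 1 ≤ u ^ 60 := one_le_pow₀ (by linarith)
  have h61 : u ^ 61 = u * u ^ 60 := by ring
  have hlogk : Real.log k ≤ u ^ 60 := by
    rcases Nat.eq_zero_or_pos k with rfl | hk0
    · simp; linarith
    · exact (Real.log_le_iff_le_exp (by exact_mod_cast hk0)).2 hk.le
  have hH : 3 * ∑ a ∈ Icc 1 k, 1 / (a : ℝ) ≤ u ^ 61 := by
    have := sum_Icc_inv_le_one_add_log k
    nlinarith
  set P := deficientPrimes m (n - k)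
  have hPm : P ⊆ m.primeFactors := deficientPrimes_subset _ _
  set P₁ := P.filter (fun p => u ^ 62 ≤ (primePart m p : ℝ))
  have hP₁m : P₁ ⊆ m.primeFactors := (filter_subset _ _).trans hPm
  refine (defectProb_le_deficient n m k).trans ?_
  refine le_trans (shapeProb_mono (q := fun s => ∀ p ∈ P₁, ∃ a ∈ s, primePart m p ∣ a)
    fun s _ hs p hp => hs p (mem_filter.1 hp).1) ?_
  rcases le_or_gt ⌊u ^ 61⌋₊ #P₁ with hR | hR
  · refine (shapeProb_primePart_le (u := u) hH (by positivity) (by positivity) hP₁m (fun p hp => ?_)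
      hR (Nat.floor_le (by positivity))).trans ((one_div_pow_floor_le hu 61).trans ?_)
    · refine le_of_eq_of_le ?_ (mem_filter.1 hp).2
      ring
    · apply Real.exp_le_exp.2
      nlinarith
  · have hcard : (#P₁ : ℝ) ≤ u ^ 61 := (Nat.cast_le.2 hR.le).trans (Nat.floor_le (by positivity))
    have hpos : (0 : ℝ) < ∏ p ∈ P₁, (primePart m p : ℝ) :=
      prod_pos fun p hp => Nat.cast_pos.2 (primePart_pos (hP₁m hp))
    refine (shapeProb_forall_exists_dvd_le _ hH (by positivity) P₁
      (fun p hp => primePart_pos (hP₁m hp))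
      (fun p hp p' hp' hne => coprime_primePart (hP₁m hp) (hP₁m hp') hne) hcard).trans ?_
    -- The prime powers below `u ^ 62` have a negligible product.
    have hsmall : ∏ p ∈ P with ¬ u ^ 62 ≤ (primePart m p : ℝ), (primePart m p : ℝ) ≤
        Real.exp (62 * u ^ 63) := by
      have hc : (#{p ∈ P | ¬ u ^ 62 ≤ (primePart m p : ℝ)} : ℝ) ≤ u ^ 62 :=
        card_le_of_forall_primePart_le ((filter_subset _ _).trans hPm) (by positivity) fun p hp =>
          (not_le.1 (mem_filter.1 hp).2).le
      calc ∏ p ∈ P with ¬ u ^ 62 ≤ (primePart m p : ℝ), (primePart m p : ℝ)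
          ≤ ∏ p ∈ P with ¬ u ^ 62 ≤ (primePart m p : ℝ), u ^ 62 :=
            prod_le_prod (fun _ _ => Nat.cast_nonneg _) fun p hp =>
              (not_le.1 (mem_filter.1 hp).2).le
        _ ≤ Real.exp ((62 : ℕ) * u * (#{p ∈ P | ¬ u ^ 62 ≤ (primePart m p : ℝ)} : ℕ)) := by
            rw [prod_const]
            exact pow_pow_le_exp (by linarith) _ _
        _ ≤ Real.exp (62 * u ^ 63) := by
            apply Real.exp_le_exp.2
            rw [show 62 * u ^ 63 = (62 : ℕ) * u * u ^ 62 by push_cast; ring]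
            gcongr
    have hprod : Real.exp (u ^ 64 / 2 - 62 * u ^ 63) ≤ ∏ p ∈ P₁, (primePart m p : ℝ) := by
      have h1 : (m : ℝ) ≤ (n - k : ℕ) * ∏ p ∈ P, (primePart m p : ℝ) := by
        exact_mod_cast le_mul_prod_deficientPrimes hm (show 0 < n - k by lia)
      have h2 : Real.exp (u ^ 64 / 2) ≤ ∏ p ∈ P, (primePart m p : ℝ) :=
        le_of_mul_le_mul_left (hlarge.trans h1) (Nat.cast_pos.2 (by lia))
      rw [← prod_filter_mul_prod_filter_not P (fun p => u ^ 62 ≤ (primePart m p : ℝ))] at h2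
      rw [Real.exp_sub, div_le_iff₀ (Real.exp_pos _)]
      refine h2.trans ?_
      gcongr
    have hnum : (u ^ 61) ^ #P₁ ≤ Real.exp (61 * u ^ 62) := by
      refine (pow_pow_le_exp (by linarith) _ _).trans (Real.exp_le_exp.2 ?_)
      rw [show 61 * u ^ 62 = (61 : ℕ) * u * u ^ 61 by push_cast; ring]
      gcongr
    calc (u ^ 61) ^ #P₁ / ∏ p ∈ P₁, (primePart m p : ℝ)
        ≤ Real.exp (61 * u ^ 62) / Real.exp (u ^ 64 / 2 - 62 * u ^ 63) := by gcongr
      _ = Real.exp (61 * u ^ 62 - (u ^ 64 / 2 - 62 * u ^ 63)) := by rw [← Real.exp_sub]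
      _ ≤ Real.exp (-(2 * u ^ 60)) := by
          apply Real.exp_le_exp.2
          have h63 : u ^ 63 = u * u ^ 62 := by ring
          have h64 : u ^ 64 = u * u ^ 63 := by ring
          have a1 : u ^ 60 ≤ u ^ 62 := pow_le_pow_right₀ (by linarith) (by norm_num)
          have a2 : u ^ 62 ≤ u ^ 63 := pow_le_pow_right₀ (by linarith) (by norm_num)
          have a3 : 1000 * u ^ 63 ≤ u ^ 64 := by
            rw [h64]
            gcongr
          linarith

/-- Two distinct contributing defects below `exp (8 u ^ 60)` make `m` large compared with all the
cycle lengths involved. -/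
theorem mul_exp_le_of_two_defects {n m k k' : ℕ} {u : ℝ} (hu : 1000 ≤ u)
    (hn : Real.log n = u ^ 64) (hm : m ≠ 0) (hk : k ∈ dvdDefects n m) (hk' : k' ∈ dvdDefects n m)
    (hne : k ≠ k') (hkx : (k : ℝ) < Real.exp (8 * u ^ 60))
    (hkx' : (k' : ℝ) < Real.exp (8 * u ^ 60)) : (n - k : ℕ) * Real.exp (u ^ 64 / 2) ≤ m := by
  have hlt' := mem_range.1 (mem_filter.1 hk').1
  have h1 : ((n - k : ℕ) : ℝ) * (n - k' : ℕ) ≤ Real.exp (8 * u ^ 60) * m := by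
    have h := mul_sub_le_mul_of_mem_dvdDefects hm hk hk' hne
    have h' : ((n - k : ℕ) : ℝ) * (n - k' : ℕ) ≤ (max k k' : ℕ) * m := by exact_mod_cast h
    refine h'.trans (mul_le_mul_of_nonneg_right ?_ (Nat.cast_nonneg _))
    rcases max_choice k k' with h | h <;> rw [h]
    · exact hkx.le
    · exact hkx'.le
  have h2 : Real.exp (8 * u ^ 60) * Real.exp (u ^ 64 / 2) ≤ (n - k' : ℕ) := by
    have h60 : 1 ≤ u ^ 60 := one_le_pow₀ (by linarith)
    have h64 : u ^ 64 = u ^ 4 * u ^ 60 := by ring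
    have h4 : (1000 : ℝ) ≤ u ^ 4 := hu.trans (le_self_pow₀ (by linarith) (by norm_num))
    have h3 : Real.exp (8 * u ^ 60) * Real.exp (u ^ 64 / 2) ≤ Real.exp (u ^ 64 - 1) := by
      rw [← Real.exp_add]
      apply Real.exp_le_exp.2
      nlinarith
    have h5 : Real.exp (8 * u ^ 60) ≤ Real.exp (u ^ 64 - 1) := by
      apply Real.exp_le_exp.2
      nlinarith
    have h6 : 2 * Real.exp (u ^ 64 - 1) ≤ Real.exp (u ^ 64) := by
      rw [Real.exp_sub, mul_div_assoc', div_le_iff₀ (Real.exp_pos _), mul_comm]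
      gcongr
      linarith [Real.add_one_le_exp (1 : ℝ)]
    rw [Nat.cast_sub hlt'.le, eq_exp_of_log_eq hu hn]
    linarith
  refine le_of_mul_le_mul_left ?_ (Real.exp_pos (8 * u ^ 60))
  calc Real.exp (8 * u ^ 60) * ((n - k : ℕ) * Real.exp (u ^ 64 / 2))
      = (n - k : ℕ) * (Real.exp (8 * u ^ 60) * Real.exp (u ^ 64 / 2)) := by ring
    _ ≤ (n - k : ℕ) * (n - k' : ℕ) := by gcongr
    _ ≤ _ := h1

theorem exp_neg_le_of_le {x y : ℝ} (hy : 0 ≤ y) (h : y ≤ x) : Real.exp (-x) ≤ 1 / (1 + y) := by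
  rw [Real.exp_neg, ← one_div]
  exact one_div_le_one_div_of_le (by linarith) (by linarith [Real.add_one_le_exp x])

theorem nat_mul_orderProb_lt_one_of_two_defects {n m k₁ k₂ : ℕ} {u : ℝ} (hu : 1000 ≤ u)
    (hn : Real.log n = u ^ 64) (hm : m ≠ 0) (hω : (#m.primeFactors : ℝ) ≤ 2 * u ^ 66)
    (hk₁ : k₁ ∈ dvdDefects n m) (hk₂ : k₂ ∈ dvdDefects n m) (hne : k₁ ≠ k₂)
    (hx₁ : (k₁ : ℝ) < Real.exp (8 * u ^ 60)) (hx₂ : (k₂ : ℝ) < Real.exp (8 * u ^ 60)) :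
    n * orderProb n m < 1 := by
  have h60 : u ≤ u ^ 60 := le_self_pow₀ (by linarith) (by norm_num)
  rw [nat_mul_orderProb, ← sum_filter_add_sum_filter_not _ (fun k : ℕ => Real.exp (u ^ 60) ≤ k)]
  have h1 := sum_defectProb_le (n := n) hm hu hω le_rfl
    (filter_subset (fun k : ℕ => Real.exp (u ^ 60) ≤ k) (dvdDefects n m))
    fun k hk => (mem_filter.1 hk).2
  have h2 : ∑ k ∈ (dvdDefects n m).filter (fun k : ℕ => ¬ Real.exp (u ^ 60) ≤ k), defectProb n m k ≤
      (1 + Real.exp (u ^ 60)) * Real.exp (-(2 * u ^ 60)) := by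
    calc ∑ k ∈ (dvdDefects n m).filter (fun k : ℕ => ¬ Real.exp (u ^ 60) ≤ k), defectProb n m k
        ≤ ∑ k ∈ (dvdDefects n m).filter (fun k : ℕ => ¬ Real.exp (u ^ 60) ≤ k),
            Real.exp (-(2 * u ^ 60)) := by
          refine sum_le_sum fun k hk => ?_
          obtain ⟨hk, hkx⟩ := mem_filter.1 hk
          push Not at hkx
          have hkx' : (k : ℝ) < Real.exp (8 * u ^ 60) :=
            hkx.trans_le (Real.exp_le_exp.2 (by linarith))
          refine defectProb_le_exp_of_large hu hm (mem_range.1 (mem_filter.1 hk).1) hkx ?_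
          by_cases h : k = k₁
          · exact mul_exp_le_of_two_defects hu hn hm hk hk₂ (h ▸ hne) hkx' hx₂
          · exact mul_exp_le_of_two_defects hu hn hm hk hk₁ h hkx' hx₁
      _ ≤ _ := by
          rw [sum_const, nsmul_eq_mul]
          gcongr
          have hsub : (dvdDefects n m).filter (fun k : ℕ => ¬ Real.exp (u ^ 60) ≤ (k : ℝ)) ⊆
              range (⌊Real.exp (u ^ 60)⌋₊ + 1) := by
            intro k hk
            have := (mem_filter.1 hk).2
            push Not at this
            exact mem_range.2 (Nat.lt_succ_of_le (Nat.le_floor this.le))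
          have h := card_le_card hsub
          rw [card_range] at h
          have h' : (#((dvdDefects n m).filter (fun k : ℕ => ¬ Real.exp (u ^ 60) ≤ (k : ℝ))) : ℝ) ≤
            ⌊Real.exp (u ^ 60)⌋₊ + 1 := by exact_mod_cast h
          linarith [Nat.floor_le (Real.exp_pos (u ^ 60)).le]
  have h3 : (1 + Real.exp (u ^ 60)) * Real.exp (-(2 * u ^ 60)) =
      Real.exp (-(2 * u ^ 60)) + Real.exp (-u ^ 60) := by
    rw [add_mul, one_mul, ← Real.exp_add]
    ring_nf
  have h4 := exp_neg_le_of_le (x := u ^ 60 / 4) (y := 250) (by norm_num) (by linarith)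
  have h5 := exp_neg_le_of_le (x := 2 * u ^ 60) (y := 250) (by norm_num) (by linarith)
  have h6 := exp_neg_le_of_le (x := u ^ 60) (y := 250) (by norm_num) (by linarith)
  rw [← neg_div] at h4
  norm_num at h4 h5 h6
  linarith

/-- The upper bound for all `m`, and strict inequality for `m` outside the exceptional set, for
`n = exp (u ^ 64)` with `u` large. -/
theorem nat_mul_orderProb_bounds {n m : ℕ} {u : ℝ} (hu : 1000 ≤ u) (hn : Real.log n = u ^ 64) :
    n * orderProb n m ≤ 1 + 2 * Real.exp (-(2 * u ^ 60)) ∧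
      ((∀ k ∈ cycleDefects n, m ≠ n - k) → n * orderProb n m < 1) := by
  have hpos : 0 < Real.exp (-(2 * u ^ 60)) := Real.exp_pos _
  have h60 : u ≤ u ^ 60 := le_self_pow₀ (by linarith) (by norm_num)
  have h2x := exp_neg_le_of_le (x := 2 * u ^ 60) (y := 3) (by norm_num) (by linarith)
  suffices h : n * orderProb n m < 1 ∨ (n * orderProb n m ≤ 1 + 2 * Real.exp (-(2 * u ^ 60)) ∧
      ∃ k ∈ cycleDefects n, m = n - k) by
    rcases h with h | ⟨h, k, hk, hmk⟩
    · exact ⟨by linarith, fun _ => h⟩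
    · exact ⟨h, fun h' => absurd hmk (h' k hk)⟩
  rcases eq_or_ne m 0 with rfl | hm
  · left
    have h0 : orderProb n 0 = 0 := by
      rw [orderProb, card_eq_zero.2 (filter_eq_empty_iff.2 fun σ _ => (orderOf_pos σ).ne')]
      simp
    simp [h0]
  rcases le_or_gt ⌊u ^ 65⌋₊ #{p ∈ m.primeFactors | u ^ 66 ≤ (primePart m p : ℝ)} with hR | hR
  · left
    refine (nat_mul_orderProb_le_of_many hu hn hR).trans_lt ?_
    rw [Real.exp_lt_one_iff, neg_lt_zero]
    positivity
  have hω := card_primeFactors_le hu hR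
  by_cases htwo : ∃ k₁ ∈ dvdDefects n m, ∃ k₂ ∈ dvdDefects n m, k₁ ≠ k₂ ∧
      (k₁ : ℝ) < Real.exp (8 * u ^ 60) ∧ (k₂ : ℝ) < Real.exp (8 * u ^ 60)
  · obtain ⟨k₁, hk₁, k₂, hk₂, hne, hx₁, hx₂⟩ := htwo
    exact Or.inl (nat_mul_orderProb_lt_one_of_two_defects hu hn hm hω hk₁ hk₂ hne hx₁ hx₂)
  -- At most one contributing defect is below `exp (8 u ^ 60)`. If it is below `exp (u ^ 60)`, all
  -- others are far enough for their total to be smaller than `1 / k₀`.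
  push Not at htwo
  by_cases hone : ∃ k₀ ∈ dvdDefects n m, (k₀ : ℝ) < Real.exp (u ^ 60)
  · obtain ⟨k₀, hk₀, hx₀⟩ := hone
    have hfar := sum_defectProb_le (n := n) (x := 8 * u ^ 60) hm hu hω (by linarith)
      (erase_subset k₀ (dvdDefects n m)) fun k hk => htwo k₀ hk₀ k (mem_of_mem_erase hk)
        (ne_of_mem_erase hk).symm (hx₀.trans_le (Real.exp_le_exp.2 (by linarith)))
    rw [show -(8 * u ^ 60) / 4 = -(2 * u ^ 60) by ring] at hfar
    have hsum : n * orderProb n m = defectProb n m k₀ +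
        ∑ k ∈ (dvdDefects n m).erase k₀, defectProb n m k := by
      rw [nat_mul_orderProb, add_sum_erase _ _ hk₀]
    have hk₀' := mem_filter.1 hk₀
    by_cases hgood : m = n - k₀ ∧ (Icc 1 k₀).lcm id ∣ m
    · right
      refine ⟨by linarith [defectProb_le_one n m k₀], k₀, ?_, hgood.1⟩
      exact mem_filter.2 ⟨hk₀'.1, hgood.1 ▸ hgood.2⟩
    · left
      rcases defectProb_eq_zero_or_le hm hk₀'.2 hgood with h0 | ⟨hk1, hle⟩
      · norm_num at h2x
        linarith
      · have hk1' : (0 : ℝ) < k₀ := by exact_mod_cast hk1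
        have hle' : defectProb n m k₀ ≤ 1 - 1 / k₀ := by
          rw [mul_comm, ← le_div_iff₀ hk1', sub_div, div_self hk1'.ne'] at hle
          exact hle
        have hinv : Real.exp (-u ^ 60) ≤ 1 / k₀ := by
          rw [Real.exp_neg, ← one_div]
          exact one_div_le_one_div_of_le hk1' hx₀.le
        have hsq : Real.exp (-(2 * u ^ 60)) = Real.exp (-u ^ 60) * Real.exp (-u ^ 60) := by
          rw [← Real.exp_add]
          ring_nf
        have hx := exp_neg_le_of_le (x := u ^ 60) (y := 3) (by norm_num) (by linarith)
        have hxpos := Real.exp_pos (-u ^ 60)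
        norm_num at hx
        nlinarith
  · left
    push Not at hone
    have hfar := sum_defectProb_le (n := n) (x := u ^ 60) hm hu hω le_rfl
      (subset_refl (dvdDefects n m)) hone
    have h4 := exp_neg_le_of_le (x := u ^ 60 / 4) (y := 3) (by norm_num) (by linarith)
    rw [← neg_div] at h4
    rw [nat_mul_orderProb]
    norm_num at h4
    linarith

/-! ### The most likely order -/

theorem one_le_nat_mul_orderProb_self {n : ℕ} (hn : 0 < n) : 1 ≤ n * orderProb n n := by
  have h0 : 0 ∈ dvdDefects n n := mem_filter.2 ⟨mem_range.2 hn, by simp⟩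
  have h1 : defectProb n n 0 = 1 := by
    refine shapeProb_eq_one fun s hs => ?_
    rw [cycleShapes_zero, mem_singleton] at hs
    simp [hs]
  rw [nat_mul_orderProb, ← h1]
  exact single_le_sum (f := fun k => defectProb n n k) (fun k _ => defectProb_nonneg n n k) h0

theorem eventually_log_eq_pow :
    ∀ᶠ n : ℕ in Filter.atTop, 1000 ≤ Real.log n ^ (1 / 64 : ℝ) ∧
      Real.log n = (Real.log n ^ (1 / 64 : ℝ)) ^ 64 := by
  have hlog : Filter.Tendsto (fun n : ℕ => Real.log n) Filter.atTop Filter.atTop :=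
    Real.tendsto_log_atTop.comp tendsto_natCast_atTop_atTop
  filter_upwards [((tendsto_rpow_atTop (show (0 : ℝ) < 1 / 64 by norm_num)).comp
    hlog).eventually_ge_atTop 1000, hlog.eventually_ge_atTop 0] with n h1 h2
  refine ⟨h1, ?_⟩
  rw [← Real.rpow_natCast, ← Real.rpow_mul h2]
  norm_num

theorem theorem1 :
    Asymptotics.IsEquivalent Filter.atTop maxOrderProb (fun n : ℕ => 1 / (n : ℝ)) ∧
    ∀ᶠ n : ℕ in Filter.atTop, ∀ m : ℕ, 1 / (n : ℝ) ≤ orderProb n m →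
      ∃ k ∈ cycleDefects n, m = n - k := by
  have hpos : ∀ᶠ n : ℕ in Filter.atTop, 0 < n := Filter.eventually_gt_atTop 0
  constructor
  · have hne : ∀ᶠ n : ℕ in Filter.atTop, (1 / (n : ℝ)) ≠ 0 := by
      filter_upwards [hpos] with n hn
      positivity
    rw [Asymptotics.isEquivalent_iff_tendsto_one hne]
    have hlog : Filter.Tendsto (fun n : ℕ => Real.log n) Filter.atTop Filter.atTop :=
      Real.tendsto_log_atTop.comp tendsto_natCast_atTop_atTop
    have hu : Filter.Tendsto (fun n : ℕ => Real.log n ^ (1 / 64 : ℝ)) Filter.atTop Filter.atTop :=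
      (tendsto_rpow_atTop (by norm_num)).comp hlog
    have hlim : Filter.Tendsto
        (fun n : ℕ => 1 + 2 * Real.exp (-(2 * (Real.log n ^ (1 / 64 : ℝ)) ^ 60)))
        Filter.atTop (nhds (1 + 2 * 0)) := by
      refine ((Real.tendsto_exp_neg_atTop_nhds_zero.comp ?_).const_mul 2).const_add 1
      exact ((Filter.tendsto_pow_atTop (by norm_num)).comp hu).const_mul_atTop (by norm_num)
    rw [mul_zero, add_zero] at hlim
    refine tendsto_of_tendsto_of_tendsto_of_le_of_le' tendsto_const_nhds hlim ?_ ?_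
    · filter_upwards [hpos] with n hn
      have hle : orderProb n n ≤ maxOrderProb n := (isGreatest_maxOrderProb n).2 ⟨n, rfl⟩
      rw [Pi.div_apply, div_div_eq_mul_div, div_one, mul_comm]
      exact (one_le_nat_mul_orderProb_self hn).trans (by gcongr)
    · filter_upwards [eventually_log_eq_pow] with n hn
      obtain ⟨m, hm⟩ := (isGreatest_maxOrderProb n).1
      rw [Pi.div_apply, div_div_eq_mul_div, div_one, mul_comm, ← hm]
      exact (nat_mul_orderProb_bounds hn.1 hn.2).1
  · filter_upwards [eventually_log_eq_pow, hpos] with n hn hn0 m hm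
    by_contra h
    push Not at h
    have hlt := (nat_mul_orderProb_bounds hn.1 hn.2).2 h
    rw [div_le_iff₀ (by exact_mod_cast hn0), mul_comm] at hm
    linarith
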